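/- **Computational model.** Algorithms are deterministic programs of a unit-cost word RAM (with a read-only input array). A function $f:\mathbb N\to\mathbb N$ is *polynomially below* $n^{a}$ if $f(n)=O(n^{a-\varepsilon})$ for some constant $\varepsilon>0$. **SETH.** The Strong Exponential Time Hypothesis says: for every $\varepsilon>0$ there is a $k$ such that satisfiability of $k$-CNF formulas (with distinct clauses) on $N$ variables cannot be decided in time $2^{(1-\varepsilon)N}\cdot N^{O(1)}$ on words of $O(N)$ bits. **Oracles.** Let $d:\mathbb N\to\mathbb N$. A *$d$-vertex-failure global connectivity oracle* with construction time $c(n)$ and update (query) time $q(n)$ consists of two algorithms on words of $O(\log n)$ bits. The first is given the number $n\ge 1$ of vertices and the list of edges of an $n$-vertex undirected simple graph $G=(V,E)$, together with the number $d(n)$, and builds a data structure in memory in at most $c(n)$ steps. The second, started on this data structure and given a set $D\subsetneq V$ with $|D|\le d(n)$, decides in at most $q(n)$ steps whether $G\setminus D$ is connected. **Theorem.** Assume SETH. Then there is a function $d(n)=n^{o(1)}$ such that for every constant $t>0$ there is no $d$-vertex-failure global connectivity oracle whose construction time $c(n)$ is polynomially below $n^{1+t}$ and whose update time $q(n)$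 is polynomially below $n$. In particular (as $t$ is arbitrary), no such oracle with construction time polynomial in $n$ has update time $O(n^{1-\varepsilon})$ for a constant $\varepsilon>0$. -/

import Mathlib

open Filter Asymptotics

/-! ### The word RAM

Programs are structured (sequencing, branching, loops) over the usual unit-cost word RAM
instructions; jumps can be simulated by a loop with a program counter at constant-factor cost.
A program uses finitely many registers, an unbounded random access memory, and a read-only
input array. All registers and memory cells hold words of `w` bits; an instruction whose result
does not fit into a word has no valid execution, so an algorithm has to avoid overflow. -/

namespace WordRAM

/-- Arithmetic, comparison and bitwise word operations. -/
inductive Op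
  | add | sub | mul | div | mod | lt | eq | band | bor | bxor | shl | shr

/-- The value of an operation (truncated subtraction; division by zero gives `0`). -/
def Op.eval : Op → ℕ → ℕ → ℕ
  | .add, a, b => a + b
  | .sub, a, b => a - b
  | .mul, a, b => a * b
  | .div, a, b => a / b
  | .mod, a, b => a % b
  | .lt, a, b => if a < b then 1 else 0
  | .eq, a, b => if a = b then 1 else 0
  | .band, a, b => a &&& b
  | .bor, a, b => a ||| b
  | .bxor, a, b => a ^^^ b
  | .shl, a, b => a <<< b
  | .shr, a, b => a >>> b

/-- Word RAM programs; `x`, `y`, `z` are register names. -/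
inductive Prog
  /-- do nothing -/
  | skip
  /-- `x := a` for a constant `a` -/
  | imm (x a : ℕ)
  /-- `x := y o z` -/
  | calc (o : Op) (x y z : ℕ)
  /-- `x := input[y]` -/
  | read (x y : ℕ)
  /-- `x := memory[y]` -/
  | load (x y : ℕ)
  /-- `memory[x] := y` -/
  | store (x y : ℕ)
  /-- run `p`, then `q` -/
  | seq (p q : Prog)
  /-- if `x ≠ 0` run `p`, else run `q` -/
  | branch (x : ℕ) (p q : Prog)
  /-- while `x ≠ 0` run `p` -/
  | loop (x : ℕ) (p : Prog)

/-- Contents of the registers and of the memory. -/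
structure State where
  reg : ℕ → ℕ
  mem : ℕ → ℕ

/-- The initial state: all registers and memory cells are zero. -/
def State.init : State := ⟨fun _ => 0, fun _ => 0⟩

def State.setReg (s : State) (x v : ℕ) : State := ⟨Function.update s.reg x v, s.mem⟩

def State.setMem (s : State) (a v : ℕ) : State := ⟨s.reg, Function.update s.mem a v⟩

/-- Set all registers to zero and keep the memory. -/
def State.clearReg (s : State) : State := ⟨fun _ => 0, s.mem⟩

/-- `Exec w inp p s τ s'`: with words of `w` bits and input array `inp` (zero beyond its end),
the program `p` started in state `s` halts in state `s'` after exactly `τ` steps, without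
overflow. Every instruction and every test of a branch or loop takes one step. -/
inductive Exec (w : ℕ) (inp : List ℕ) : Prog → State → ℕ → State → Prop
  | skip (s : State) : Exec w inp .skip s 1 s
  | imm (s : State) (x a : ℕ) (h : a < 2 ^ w) :
      Exec w inp (.imm x a) s 1 (s.setReg x a)
  | calc (s : State) (o : Op) (x y z : ℕ) (h : o.eval (s.reg y) (s.reg z) < 2 ^ w) :
      Exec w inp (.calc o x y z) s 1 (s.setReg x (o.eval (s.reg y) (s.reg z)))
  | read (s : State) (x y : ℕ) (h : inp.getD (s.reg y) 0 < 2 ^ w) :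
      Exec w inp (.read x y) s 1 (s.setReg x (inp.getD (s.reg y) 0))
  | load (s : State) (x y : ℕ) :
      Exec w inp (.load x y) s 1 (s.setReg x (s.mem (s.reg y)))
  | store (s : State) (x y : ℕ) :
      Exec w inp (.store x y) s 1 (s.setMem (s.reg x) (s.reg y))
  | seq (p q : Prog) (s s' s'' : State) (τ τ' : ℕ)
      (hp : Exec w inp p s τ s') (hq : Exec w inp q s' τ' s'') :
      Exec w inp (.seq p q) s (τ + τ') s''
  | branch_true (x : ℕ) (p q : Prog) (s s' : State) (τ : ℕ) (hx : s.reg x ≠ 0)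
      (hp : Exec w inp p s τ s') : Exec w inp (.branch x p q) s (τ + 1) s'
  | branch_false (x : ℕ) (p q : Prog) (s s' : State) (τ : ℕ) (hx : s.reg x = 0)
      (hq : Exec w inp q s τ s') : Exec w inp (.branch x p q) s (τ + 1) s'
  | loop_done (x : ℕ) (p : Prog) (s : State) (hx : s.reg x = 0) :
      Exec w inp (.loop x p) s 1 s
  | loop_step (x : ℕ) (p : Prog) (s s' s'' : State) (τ τ' : ℕ) (hx : s.reg x ≠ 0)
      (hp : Exec w inp p s τ s') (hl : Exec w inp (.loop x p) s' τ' s'') :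
      Exec w inp (.loop x p) s (τ + τ' + 1) s''

end WordRAM

open WordRAM

/-! ### k-SAT and the Strong Exponential Time Hypothesis -/

/-- A literal over the variables `0, …, N - 1`: a variable and its sign
(`true` for the variable, `false` for its negation). -/
abbrev Literal (N : ℕ) := Fin N × Bool

/-- A clause of a `k`-CNF formula: `k` literals, repetitions allowed (so that clauses with fewer
than `k` literals are included). -/
abbrev KClause (k N : ℕ) := Fin k → Literal N

/-- Satisfiability of the conjunction of a list of clauses. -/
def Satisfiable {k N : ℕ} (φ : List (KClause k N)) : Prop :=
  ∃ σ : Fin N → Bool, ∀ cl ∈ φ, ∃ i, σ (cl i).1 = (cl i).2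

def encodeLiteral {N : ℕ} (l : Literal N) : ℕ := 2 * l.1 + if l.2 then 1 else 0

/-- The input array for a formula: number of variables, number of clauses, then the literals,
clause by clause. -/
def encodeFormula {k N : ℕ} (φ : List (KClause k N)) : List ℕ :=
  N :: φ.length :: φ.flatMap fun cl => List.ofFn fun i => encodeLiteral (cl i)

/-- The program `p` decides satisfiability of `k`-CNF formulas: for every formula on `N` variables
(a list of distinct clauses) it halts within `T N` steps on words of `c * (N + 1)` bits, and
register `0` is then nonzero iff the formula is satisfiable. -/
def SolvesKSAT (k : ℕ) (p : Prog) (c : ℕ) (T : ℕ → ℕ) : Prop :=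
  ∀ (N : ℕ) (φ : List (KClause k N)), φ.Nodup →
    ∃ (τ : ℕ) (s : State), τ ≤ T N ∧
      Exec (c * (N + 1)) (encodeFormula φ) p State.init τ s ∧
      (s.reg 0 ≠ 0 ↔ Satisfiable φ)

/-- The Strong Exponential Time Hypothesis: for every `ε > 0` there is a `k` such that no algorithm
decides `k`-CNF formulas on `N` variables in time `2 ^ ((1 - ε) N)` up to factors that are
polynomial in `N`, i.e. polylogarithmic in `2 ^ N`. -/
def SETH : Prop :=
  ∀ ε : ℝ, 0 < ε → ∃ k : ℕ, ¬ ∃ (p : Prog) (c : ℕ) (T : ℕ → ℕ) (a : ℕ),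
    SolvesKSAT k p c T ∧
    (fun N : ℕ => (T N : ℝ)) =O[atTop]
      (fun N : ℕ => (N : ℝ) ^ a * (2 : ℝ) ^ ((1 - ε) * (N : ℝ)))

/-! ### Vertex-failure global connectivity oracles -/

/-- `es` lists the edges `uv`, `u < v`, of `G`, each exactly once, in any order. -/
def IsEdgeList {n : ℕ} (G : SimpleGraph (Fin n)) (es : List (Fin n × Fin n)) : Prop :=
  es.Nodup ∧ ∀ u v : Fin n, (u, v) ∈ es ↔ u < v ∧ G.Adj u v

/-- The input array of the construction phase: the number of vertices, the number of edges, the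
bound `d` on the number of failures, then the edges. -/
def encodeGraph (n d : ℕ) (es : List (Fin n × Fin n)) : List ℕ :=
  n :: es.length :: d :: es.flatMap fun e => [(e.1 : ℕ), (e.2 : ℕ)]

/-- The input array of the update phase: the number of failed vertices, then these vertices. -/
def encodeFailures {n : ℕ} (D : List (Fin n)) : List ℕ :=
  D.length :: D.map fun v => (v : ℕ)

/-- The pair of programs `P` (construction) and `Q` (update) is an oracle for global connectivity
under up to `d n` vertex failures, on words of `O(log n)` bits: for every `n`-vertex graph, `P` halts
within `tc n` steps, leaving a data structure in memory; for every set `D` of at most `d n`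
vertices, other than the whole vertex set, `Q` started on this memory halts within `tq n` steps, and
register `0` is then nonzero iff the graph with `D` deleted is connected. Only one set `D` is
processed after the construction: nothing is required of the memory that `Q` leaves behind. -/
def IsGlobalConnectivityOracle (d : ℕ → ℕ) (P Q : Prog) (c : ℕ) (tc tq : ℕ → ℕ) : Prop :=
  ∀ (n : ℕ) (G : SimpleGraph (Fin n)) (es : List (Fin n × Fin n)), 1 ≤ n → IsEdgeList G es →
    ∃ (τ : ℕ) (s : State), τ ≤ tc n ∧
      Exec (c * (Nat.log 2 n + 1)) (encodeGraph n (d n) es) P State.init τ s ∧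
      ∀ D : List (Fin n), D.Nodup → D.length ≤ d n → D.length < n →
        ∃ (τ' : ℕ) (s' : State), τ' ≤ tq n ∧
          Exec (c * (Nat.log 2 n + 1)) (encodeFailures D) Q s.clearReg τ' s' ∧
          (s'.reg 0 ≠ 0 ↔ (G.induce {v : Fin n | v ∉ D}).Connected)

/-! ### Asymptotic classes -/

/-- `f(n)` is polynomially below `n ^ a`: `f(n) = O(n ^ (a - ε))` for some constant `ε > 0`. -/
def PolyBelow (f : ℕ → ℕ) (a : ℝ) : Prop :=
  ∃ ε : ℝ, 0 < ε ∧ (fun n : ℕ => (f n : ℝ)) =O[atTop] (fun n : ℕ => (n : ℝ) ^ (a - ε))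

/-- `f(n) = n ^ o(1)`. -/
def IsSubpolynomial (f : ℕ → ℕ) : Prop :=
  ∀ δ : ℝ, 0 < δ → (fun n : ℕ => (f n : ℝ)) =O[atTop] (fun n : ℕ => (n : ℝ) ^ δ)

/-!
An oracle with fast updates would solve `k`-SAT too quickly. Given a `k`-CNF formula on `N`
variables with `m` distinct clauses, split off `a = N / q` variables and build a graph on
`n = 2 ^ (a + K)` vertices: the `m` clauses, a hub joined to all clauses, and vertices for the
assignments to the first `a` variables, each joined to the clauses that it does not satisfy. For
an assignment `b` to the other `N - a` variables, delete the clauses satisfied by `b`. The rest is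
disconnected iff one of the assignment vertices is isolated, that is, iff it satisfies all clauses
that `b` does not satisfy (`connected_reductionGraph_iff`). So the formula is satisfiable iff one
of these `2 ^ (N - a)` queries finds the graph disconnected (`satisfiable_iff_not_connected`).

At most `m ≤ (2 N) ^ k` vertices are deleted, which is polylogarithmic in `n`. Hence the bound
`d n = 2 ^ √(log₂ n)`, which does not depend on `k` and is `n ^ o(1)`, suffices for every `k`,
once the graph is padded by a constant factor `2 ^ K` (`exists_padding`); no sparsification is
needed. With `q ≥ 2 (1 + t)` the construction takes time `O(2 ^ (N / 2))`, and the queries take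
time `2 ^ (N - a) * n ^ (1 - ε)`, about `2 ^ ((1 - ε / q) N)`, in total (`isBigO_solverTime`). As
`ε` and `q` do not depend on `k`, this contradicts the hypothesis.

The reduction is carried out by an explicit word RAM program, `Prog.solver`, which contains the
programs of the oracle, transformed by `Prog.simulate`: their registers are renamed, and their
memory and input are embedded into the memory of the solver. The oracle guarantees nothing after
its first update, so each query has to start from the memory left by the construction. Copying it
would take too long; instead, the writes of a query go to a second layer of the memory and carry a
time stamp, and later queries disregard them. The simulation is verified in
`Represents.runs_simulate`, the solver in `runs_solver` and `solvesKSAT_solver`.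
-/

namespace WordRAM

/-! ### Running programs within a time bound -/

/-- `p`, started in `s`, halts within `B` steps in a state satisfying `Q`. -/
def Runs (w : ℕ) (inp : List ℕ) (p : Prog) (s : State) (B : ℕ) (Q : State → Prop) : Prop :=
  ∃ (τ : ℕ) (s' : State), τ ≤ B ∧ Exec w inp p s τ s' ∧ Q s'

@[simp] theorem State.setReg_reg (s : State) (x v y : ℕ) :
    (s.setReg x v).reg y = if y = x then v else s.reg y := by
  simp [State.setReg, Function.update_apply]

@[simp] theorem State.setReg_mem (s : State) (x v : ℕ) : (s.setReg x v).mem = s.mem := rfl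

@[simp] theorem State.setMem_reg (s : State) (a v : ℕ) : (s.setMem a v).reg = s.reg := rfl

@[simp] theorem State.setMem_mem (s : State) (a v b : ℕ) :
    (s.setMem a v).mem b = if b = a then v else s.mem b := by
  simp [State.setMem, Function.update_apply]

variable {w : ℕ} {inp : List ℕ} {p q : Prog} {s : State} {B B' : ℕ} {Q Q' : State → Prop}

theorem Runs.mono (h : Runs w inp p s B Q) (hB : B ≤ B') (hQ : ∀ s', Q s' → Q' s') :
    Runs w inp p s B' Q' := by
  obtain ⟨τ, s', hτ, he, hq⟩ := h
  exact ⟨τ, s', hτ.trans hB, he, hQ _ hq⟩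

theorem Runs.skip (h : Q s) : Runs w inp .skip s 1 Q := ⟨_, _, le_rfl, .skip s, h⟩

theorem Runs.imm {x a : ℕ} (h : a < 2 ^ w) (hQ : Q (s.setReg x a)) :
    Runs w inp (.imm x a) s 1 Q := ⟨_, _, le_rfl, .imm s x a h, hQ⟩

theorem Runs.calc {o : Op} {x y z : ℕ} (h : o.eval (s.reg y) (s.reg z) < 2 ^ w)
    (hQ : Q (s.setReg x (o.eval (s.reg y) (s.reg z)))) :
    Runs w inp (.calc o x y z) s 1 Q := ⟨_, _, le_rfl, .calc s o x y z h, hQ⟩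

theorem Runs.read {x y : ℕ} (h : inp.getD (s.reg y) 0 < 2 ^ w)
    (hQ : Q (s.setReg x (inp.getD (s.reg y) 0))) :
    Runs w inp (.read x y) s 1 Q := ⟨_, _, le_rfl, .read s x y h, hQ⟩

theorem Runs.load {x y : ℕ} (hQ : Q (s.setReg x (s.mem (s.reg y)))) :
    Runs w inp (.load x y) s 1 Q := ⟨_, _, le_rfl, .load s x y, hQ⟩

theorem Runs.store {x y : ℕ} (hQ : Q (s.setMem (s.reg x) (s.reg y))) :
    Runs w inp (.store x y) s 1 Q := ⟨_, _, le_rfl, .store s x y, hQ⟩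

theorem Runs.seq (h : Runs w inp p s B (fun s' => Runs w inp q s' B' Q)) :
    Runs w inp (.seq p q) s (B + B') Q := by
  obtain ⟨τ, s', hτ, he, τ', s'', hτ', he', hq⟩ := h
  exact ⟨_, s'', Nat.add_le_add hτ hτ', .seq p q _ _ _ _ _ he he', hq⟩

theorem Runs.branch {x : ℕ} (hp : s.reg x ≠ 0 → Runs w inp p s B Q)
    (hq : s.reg x = 0 → Runs w inp q s B Q) : Runs w inp (.branch x p q) s (B + 1) Q := by
  by_cases hx : s.reg x = 0
  · obtain ⟨τ, s', hτ, he, h⟩ := hq hx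
    exact ⟨_, s', Nat.succ_le_succ hτ, .branch_false x p q _ _ _ hx he, h⟩
  · obtain ⟨τ, s', hτ, he, h⟩ := hp hx
    exact ⟨_, s', Nat.succ_le_succ hτ, .branch_true x p q _ _ _ hx he, h⟩

/-- Sequential composition of a list of programs. -/
def Prog.block : List Prog → Prog
  | [] => .skip
  | p :: l => .seq p (Prog.block l)

theorem Runs.block_nil (h : Q s) : Runs w inp (.block []) s 1 Q := Runs.skip h

theorem Runs.block_cons {l : List Prog}
    (h : Runs w inp p s B (fun s' => Runs w inp (.block l) s' B' Q)) :
    Runs w inp (.block (p :: l)) s (B + B') Q := Runs.seq h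

variable {l : List Prog}

theorem Runs.block_imm {x a : ℕ} (h : a < 2 ^ w)
    (hQ : Runs w inp (.block l) (s.setReg x a) B Q) :
    Runs w inp (.block (.imm x a :: l)) s (B + 1) Q := by
  rw [Nat.add_comm]; exact Runs.block_cons (Runs.imm h hQ)

theorem Runs.block_calc {o : Op} {x y z : ℕ} (v : ℕ) (hv : o.eval (s.reg y) (s.reg z) = v)
    (h : v < 2 ^ w) (hQ : Runs w inp (.block l) (s.setReg x v) B Q) :
    Runs w inp (.block (.calc o x y z :: l)) s (B + 1) Q := by
  subst hv; rw [Nat.add_comm]; exact Runs.block_cons (Runs.calc h hQ)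

theorem Runs.block_read {x y : ℕ} (v : ℕ) (hv : inp.getD (s.reg y) 0 = v) (h : v < 2 ^ w)
    (hQ : Runs w inp (.block l) (s.setReg x v) B Q) :
    Runs w inp (.block (.read x y :: l)) s (B + 1) Q := by
  subst hv; rw [Nat.add_comm]; exact Runs.block_cons (Runs.read h hQ)

theorem Runs.block_load {x y : ℕ} (v : ℕ) (hv : s.mem (s.reg y) = v)
    (hQ : Runs w inp (.block l) (s.setReg x v) B Q) :
    Runs w inp (.block (.load x y :: l)) s (B + 1) Q := by
  subst hv; rw [Nat.add_comm]; exact Runs.block_cons (Runs.load hQ)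

theorem Runs.block_store {x y : ℕ} (b v : ℕ) (hb : s.reg x = b) (hv : s.reg y = v)
    (hQ : Runs w inp (.block l) (s.setMem b v) B Q) :
    Runs w inp (.block (.store x y :: l)) s (B + 1) Q := by
  subst hb hv; rw [Nat.add_comm]; exact Runs.block_cons (Runs.store hQ)

/-- The loop `for i := 0 to b - 1 do body` (if `i` starts at `0`): `t` is a scratch register and
`o` a register holding the constant `1`. -/
def Prog.forLoop (i b t o : ℕ) (body : Prog) : Prog :=
  .seq (.calc .lt t i b) (.loop t (.seq body (.seq (.calc .add i i o) (.calc .lt t i b))))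

theorem Op.eval_lt_le_one (a b : ℕ) : Op.eval .lt a b ≤ 1 := by
  simp only [Op.eval]; split <;> simp

/-- The invariant rule for `Prog.forLoop`. The body must leave the counter as it found it, and
`Inv (z + 1)` has to hold once the counter has been increased. -/
theorem Runs.forLoop {i b t o : ℕ} {body : Prog} {Inv : ℕ → State → Prop} {M C : ℕ}
    (hw : w ≠ 0) (hM : M < 2 ^ w)
    (hreg : ∀ z s, Inv z s → s.reg i = z ∧ s.reg b = M)
    (ht : ∀ z s v, Inv z s → Inv z (s.setReg t v))
    (hbody : ∀ z s, z < M → Inv z s → Runs w inp body s C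
      (fun s' => s'.reg i = z ∧ s'.reg o = 1 ∧ Inv (z + 1) (s'.setReg i (z + 1))))
    (h0 : Inv 0 s) : Runs w inp (.forLoop i b t o body) s (M * (C + 3) + 2) (Inv M) := by
  have h1 : 1 < 2 ^ w := Nat.one_lt_two_pow hw
  have key : ∀ j z s, z + j = M → Inv z s → s.reg t = (if z < M then 1 else 0) →
      Runs w inp (.loop t (.seq body (.seq (.calc .add i i o) (.calc .lt t i b)))) s
        (j * (C + 3) + 1) (Inv M) := by
    intro j
    induction j with
    | zero =>
      intro z s hz hI hs
      obtain rfl : z = M := by omega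
      exact ⟨1, s, by omega, .loop_done _ _ _ (by simpa using hs), hI⟩
    | succ j ih =>
      intro z s hz hI hs
      have hzM : z < M := by omega
      obtain ⟨τ, s₁, hτ, he, hi, ho, hI'⟩ := hbody z s hzM hI
      have hcalc : Op.eval .add (s₁.reg i) (s₁.reg o) = z + 1 := by simp [Op.eval, hi, ho]
      set s₂ := s₁.setReg i (z + 1) with hs₂
      set s₃ := s₂.setReg t (Op.eval .lt (s₂.reg i) (s₂.reg b)) with hs₃
      have e₂ : Exec w inp (.calc .add i i o) s₁ 1 s₂ := by
        have := Exec.calc (w := w) (inp := inp) s₁ .add i i o (by rw [hcalc]; omega)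
        rwa [hcalc] at this
      have e₃ : Exec w inp (.calc .lt t i b) s₂ 1 s₃ :=
        Exec.calc s₂ .lt t i b (lt_of_le_of_lt (Op.eval_lt_le_one _ _) h1)
      have hI₃ : Inv (z + 1) s₃ := ht _ _ _ hI'
      have hr := hreg _ _ hI'
      obtain ⟨τ', s', hτ', he', hq⟩ := ih (z + 1) s₃ (by omega) hI₃
        (by simp [hs₃, hr.1, hr.2, Op.eval])
      refine ⟨τ + (1 + 1) + τ' + 1, s', ?_, .loop_step _ _ _ _ _ _ _ (by simp [hs, hzM])
        (.seq _ _ _ _ _ _ _ he (.seq _ _ _ _ _ _ _ e₂ e₃)) he', hq⟩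
      have : (j + 1) * (C + 3) = j * (C + 3) + (C + 3) := by ring
      omega
  have hr := hreg _ _ h0
  rw [Nat.add_comm (M * (C + 3)) 2, show 2 + M * (C + 3) = 1 + (M * (C + 3) + 1) by omega]
  refine Runs.seq (Runs.calc (lt_of_le_of_lt (Op.eval_lt_le_one _ _) h1) ?_)
  exact key M 0 _ (by omega) (ht _ _ _ h0) (by simp [hr.1, hr.2, Op.eval])

/-! ### Simulating a program inside a larger one -/

/-- All registers named in the program are smaller than `R`. -/
def Prog.RegsBelow (R : ℕ) : Prog → Prop
  | .skip => True
  | .imm x _ => x < R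
  | .calc _ x y z => x < R ∧ y < R ∧ z < R
  | .read x y => x < R ∧ y < R
  | .load x y => x < R ∧ y < R
  | .store x y => x < R ∧ y < R
  | .seq p q => p.RegsBelow R ∧ q.RegsBelow R
  | .branch x p q => x < R ∧ p.RegsBelow R ∧ q.RegsBelow R
  | .loop x p => x < R ∧ p.RegsBelow R

theorem Prog.RegsBelow.mono {R R' : ℕ} (h : R ≤ R') : ∀ {p : Prog}, p.RegsBelow R → p.RegsBelow R'
  | .skip, _ => trivial
  | .imm _ _, hp => lt_of_lt_of_le hp h
  | .calc _ _ _ _, hp => ⟨hp.1.trans_le h, hp.2.1.trans_le h, hp.2.2.trans_le h⟩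
  | .read _ _, hp => ⟨hp.1.trans_le h, hp.2.trans_le h⟩
  | .load _ _, hp => ⟨hp.1.trans_le h, hp.2.trans_le h⟩
  | .store _ _, hp => ⟨hp.1.trans_le h, hp.2.trans_le h⟩
  | .seq _ _, hp => ⟨hp.1.mono h, hp.2.mono h⟩
  | .branch _ _ _, hp => ⟨hp.1.trans_le h, hp.2.1.mono h, hp.2.2.mono h⟩
  | .loop _ _, hp => ⟨hp.1.trans_le h, hp.2.mono h⟩

theorem Prog.exists_regsBelow : ∀ p : Prog, ∃ R, p.RegsBelow R
  | .skip => ⟨0, trivial⟩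
  | .imm x _ => ⟨x + 1, Nat.lt_succ_self x⟩
  | .calc _ x y z => ⟨x + y + z + 1, by simp only [RegsBelow]; omega⟩
  | .read x y => ⟨x + y + 1, by simp only [RegsBelow]; omega⟩
  | .load x y => ⟨x + y + 1, by simp only [RegsBelow]; omega⟩
  | .store x y => ⟨x + y + 1, by simp only [RegsBelow]; omega⟩
  | .seq p q => by
    obtain ⟨R, hR⟩ := exists_regsBelow p
    obtain ⟨R', hR'⟩ := exists_regsBelow q
    exact ⟨R + R', hR.mono (by omega), hR'.mono (by omega)⟩
  | .branch x p q => by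
    obtain ⟨R, hR⟩ := exists_regsBelow p
    obtain ⟨R', hR'⟩ := exists_regsBelow q
    exact ⟨x + 1 + R + R', by omega, hR.mono (by omega), hR'.mono (by omega)⟩
  | .loop x p => by
    obtain ⟨R, hR⟩ := exists_regsBelow p
    exact ⟨x + 1 + R, by omega, hR.mono (by omega)⟩

/-- The simulation of a program by one whose registers below `32` are left to the simulating
algorithm, which keeps in them the constants `4`, `2`, `3` (registers `4`, `5`, `6`), a layer
number `0` or `1` (register `14`), a time stamp (register `15`) and the length of the simulated
input (register `16`); registers `0` to `3` are scratch.

The simulated register `x` is register `x + 32`. Memory is split into four lanes. Cell `4 * a + 3`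
holds entry `a` of the simulated input. Cell `4 * a + 2` holds the time of the last write to the
simulated cell `a`; its current content is in cell `4 * a + 1` if the layer number is `1` and that
time is the current time stamp, and in cell `4 * a` otherwise. Increasing the time stamp thus
undoes all writes to layer `1` at once. -/
def Prog.simulate : Prog → Prog
  | .skip => .skip
  | .imm x a => .imm (x + 32) a
  | .calc o x y z => .calc o (x + 32) (y + 32) (z + 32)
  | .read x y => .block
      [.calc .mul 1 (y + 32) 4, .calc .add 1 1 6, .calc .lt 2 (y + 32) 16, .load 3 1,
        .calc .mul (x + 32) 2 3]
  | .load x y => .block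
      [.calc .mul 1 (y + 32) 4, .calc .add 2 1 5, .load 3 2, .calc .eq 3 3 15, .calc .mul 3 3 14,
        .calc .add 1 1 3, .load (x + 32) 1]
  | .store x y => .block
      [.calc .mul 1 (x + 32) 4, .calc .add 2 1 5, .calc .add 1 1 14, .store 1 (y + 32),
        .store 2 15]
  | .seq p q => .seq p.simulate q.simulate
  | .branch x p q => .branch (x + 32) p.simulate q.simulate
  | .loop x p => .loop (x + 32) p.simulate

/-- The state `S` of a simulation represents the state `V` of the simulated program with input
`inp`. Here `env` lists the contents of the registers of the simulating algorithm, and `base` is the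
content of layer `0`, which must not change while layer `1` is in use. -/
structure Represents (R : ℕ) (inp : List ℕ) (env base : ℕ → ℕ) (V S : State) : Prop where
  reg : ∀ x < R, S.reg (x + 32) = V.reg x
  own : ∀ r, 4 ≤ r → r < 32 → S.reg r = env r
  mem : ∀ a, V.mem a = S.mem (4 * a + if S.mem (4 * a + 2) = env 15 then env 14 else 0)
  stamp : ∀ a, S.mem (4 * a + 2) ≤ env 15
  input : ∀ y, inp.getD y 0 = if y < env 16 then S.mem (4 * y + 3) else 0
  base : env 14 = 1 → ∀ a, S.mem (4 * a) = base a

/-- Registers and memory hold words of `w` bits. -/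
def State.Bounded (w : ℕ) (s : State) : Prop := (∀ x, s.reg x < 2 ^ w) ∧ ∀ a, s.mem a < 2 ^ w

theorem State.Bounded.setReg {w : ℕ} {s : State} (h : s.Bounded w) {x v : ℕ} (hv : v < 2 ^ w) :
    (s.setReg x v).Bounded w :=
  ⟨fun y => by rw [State.setReg_reg]; split_ifs; exacts [hv, h.1 y], h.2⟩

theorem Exec.bounded {w : ℕ} {inp : List ℕ} {p : Prog} {s s' : State} {τ : ℕ}
    (h : Exec w inp p s τ s') (hs : s.Bounded w) : s'.Bounded w := by
  induction h
  · exact hs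
  · exact hs.setReg ‹_›
  · exact hs.setReg ‹_›
  · exact hs.setReg ‹_›
  · exact hs.setReg (hs.2 _)
  · refine ⟨hs.1, fun b => ?_⟩
    rw [State.setMem_mem]; split_ifs; exacts [hs.1 _, hs.2 b]
  · rename_i ihp ihq; exact ihq (ihp hs)
  · rename_i ih; exact ih hs
  · rename_i ih; exact ih hs
  · exact hs
  · rename_i ihp ihl; exact ihl (ihp hs)

theorem Represents.setReg {R : ℕ} {inp : List ℕ} {env base : ℕ → ℕ} {V S : State}
    (h : Represents R inp env base V S) (x v : ℕ) :
    Represents R inp env base (V.setReg x v) (S.setReg (x + 32) v) where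
  reg y hy := by simp [h.reg y hy]
  own r hr hr' := by
    rw [State.setReg_reg, if_neg (by omega)]; exact h.own r hr hr'
  mem := h.mem
  stamp := h.stamp
  input := h.input
  base := h.base

theorem Represents.setReg_scratch {R : ℕ} {inp : List ℕ} {env base : ℕ → ℕ} {V S : State}
    (h : Represents R inp env base V S) {x v : ℕ} (hx : x < 4) :
    Represents R inp env base V (S.setReg x v) where
  reg y hy := by
    rw [State.setReg_reg, if_neg (by omega)]; exact h.reg y hy
  own r hr hr' := by
    rw [State.setReg_reg, if_neg (by omega)]; exact h.own r hr hr'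
  mem := h.mem
  stamp := h.stamp
  input := h.input
  base := h.base

/-- A write to the simulated cell `a` in the current layer. -/
theorem Represents.setMem {R : ℕ} {inp : List ℕ} {env base : ℕ → ℕ} {V S : State}
    (h : Represents R inp env base V S) (hlayer : env 14 ≤ 1) (a v : ℕ) :
    Represents R inp env base (V.setMem a v)
      ((S.setMem (4 * a + env 14) v).setMem (4 * a + 2) (env 15)) where
  reg := h.reg
  own := h.own
  mem b := by
    simp only [State.setMem_mem]
    by_cases hb : b = a
    · subst hb
      rw [if_pos rfl, if_pos rfl, if_pos rfl, if_neg (by omega), if_pos rfl]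
    · rw [if_neg hb, h.mem b]
      rw [if_neg (c := 4 * b + 2 = 4 * a + 2) (by omega),
        if_neg (c := 4 * b + 2 = 4 * a + env 14) (by omega)]
      have : (if S.mem (4 * b + 2) = env 15 then env 14 else 0) ≤ 1 := by split_ifs <;> omega
      rw [if_neg (c := 4 * b + _ = 4 * a + 2) (by omega),
        if_neg (c := 4 * b + _ = 4 * a + env 14) (by omega)]
  stamp b := by
    simp only [State.setMem_mem]
    split_ifs
    · exact le_rfl
    · omega
    · exact h.stamp b
  input y := by
    simp only [State.setMem_mem]
    rw [h.input y]
    congr 1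
    rw [if_neg (by omega), if_neg (by omega)]
  base h1 b := by
    simp only [State.setMem_mem]
    rw [if_neg (by omega), if_neg (by omega)]
    exact h.base h1 b

section

variable {w w' R : ℕ} {inp inp' : List ℕ} {env base : ℕ → ℕ} {V V' S : State} {τ : ℕ} {p : Prog}

theorem Represents.runs_read (h : Represents R inp env base V S) (hV : V.Bounded w)
    (hw : w + 3 ≤ w') (h4 : env 4 = 4) (h6 : env 6 = 3)
    {x y : ℕ} (hy : y < R) (hin : inp.getD (V.reg y) 0 < 2 ^ w) :
    Runs w' inp' (Prog.simulate (.read x y)) S 6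
      (Represents R inp env base (V.setReg x (inp.getD (V.reg y) 0))) := by
  have hpow : 2 ^ w * 8 ≤ 2 ^ w' :=
    (pow_add 2 w 3).symm.le.trans (Nat.pow_le_pow_right (by norm_num) hw)
  have hb := hV.1 y
  have e4 := h.own 4 (by omega) (by omega)
  have e6 := h.own 6 (by omega) (by omega)
  have e16 := h.own 16 (by omega) (by omega)
  have ey := h.reg y hy
  have hle : (if V.reg y < env 16 then 1 else 0) ≤ 1 := by split_ifs <;> simp
  have hval : (if V.reg y < env 16 then 1 else 0) * S.mem (4 * V.reg y + 3)
      = inp.getD (V.reg y) 0 := by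
    rw [h.input]
    split_ifs <;> simp
  refine Runs.block_calc (4 * V.reg y) (by simp [Op.eval, e4, ey, h4, mul_comm]) (by omega) ?_
  refine Runs.block_calc (4 * V.reg y + 3) (by simp [Op.eval, e6, h6]) (by omega) ?_
  refine Runs.block_calc (if V.reg y < env 16 then 1 else 0) (by simp [Op.eval, ey, e16])
    (by omega) ?_
  refine Runs.block_load (S.mem (4 * V.reg y + 3)) (by simp) ?_
  refine Runs.block_calc (inp.getD (V.reg y) 0) (by
    rw [← hval]; simp only [Op.eval, State.setReg_reg]; rfl) (by omega) (Runs.block_nil ?_)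
  exact ((((h.setReg_scratch (by omega)).setReg_scratch (by omega)).setReg_scratch
    (by omega)).setReg_scratch (by omega)).setReg x _

theorem Represents.runs_load (h : Represents R inp env base V S) (hV : V.Bounded w)
    (hw : w + 3 ≤ w') (h4 : env 4 = 4) (h5 : env 5 = 2) (h14 : env 14 ≤ 1)
    {x y : ℕ} (hy : y < R) :
    Runs w' inp' (Prog.simulate (.load x y)) S 8
      (Represents R inp env base (V.setReg x (V.mem (V.reg y)))) := by
  have hpow : 2 ^ w * 8 ≤ 2 ^ w' :=
    (pow_add 2 w 3).symm.le.trans (Nat.pow_le_pow_right (by norm_num) hw)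
  have hb := hV.1 y
  have e4 := h.own 4 (by omega) (by omega)
  have e5 := h.own 5 (by omega) (by omega)
  have e14 := h.own 14 (by omega) (by omega)
  have e15 := h.own 15 (by omega) (by omega)
  have ey := h.reg y hy
  set t := S.mem (4 * V.reg y + 2) with ht
  have hif : (if t = env 15 then 1 else 0) * env 14 = if t = env 15 then env 14 else 0 := by
    split_ifs <;> simp
  have hle : (if t = env 15 then env 14 else 0) ≤ 1 := by split_ifs <;> omega
  refine Runs.block_calc (4 * V.reg y) (by simp [Op.eval, e4, ey, h4, mul_comm]) (by omega) ?_
  refine Runs.block_calc (4 * V.reg y + 2) (by simp [Op.eval, e5, h5]) (by omega) ?_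
  refine Runs.block_load t (by simp [ht]) ?_
  refine Runs.block_calc (if t = env 15 then 1 else 0) (by simp [Op.eval, e15])
    (by split_ifs <;> omega) ?_
  refine Runs.block_calc (if t = env 15 then env 14 else 0) (by simp [Op.eval, e14])
    (by omega) ?_
  refine Runs.block_calc (4 * V.reg y + if t = env 15 then env 14 else 0) (by simp [Op.eval])
    (by omega) ?_
  refine Runs.block_load (V.mem (V.reg y)) (by simp [h.mem (V.reg y), ht]) (Runs.block_nil ?_)
  exact ((((((h.setReg_scratch (by omega)).setReg_scratch (by omega)).setReg_scratch
    (by omega)).setReg_scratch (by omega)).setReg_scratch (by omega)).setReg_scratch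
    (by omega)).setReg x _

theorem Represents.runs_store (h : Represents R inp env base V S) (hV : V.Bounded w)
    (hw : w + 3 ≤ w') (h4 : env 4 = 4) (h5 : env 5 = 2) (h14 : env 14 ≤ 1)
    {x y : ℕ} (hx : x < R) (hy : y < R) :
    Runs w' inp' (Prog.simulate (.store x y)) S 6
      (Represents R inp env base (V.setMem (V.reg x) (V.reg y))) := by
  have hpow : 2 ^ w * 8 ≤ 2 ^ w' :=
    (pow_add 2 w 3).symm.le.trans (Nat.pow_le_pow_right (by norm_num) hw)
  have hb := hV.1 x
  have e4 := h.own 4 (by omega) (by omega)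
  have e5 := h.own 5 (by omega) (by omega)
  have e14 := h.own 14 (by omega) (by omega)
  have e15 := h.own 15 (by omega) (by omega)
  have ex := h.reg x hx
  have ey := h.reg y hy
  refine Runs.block_calc (4 * V.reg x) (by simp [Op.eval, e4, ex, h4, mul_comm]) (by omega) ?_
  refine Runs.block_calc (4 * V.reg x + 2) (by simp [Op.eval, e5, h5]) (by omega) ?_
  refine Runs.block_calc (4 * V.reg x + env 14) (by simp [Op.eval, e14]) (by omega) ?_
  refine Runs.block_store (4 * V.reg x + env 14) (V.reg y) (by simp) (by simp [ey]) ?_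
  refine Runs.block_store (4 * V.reg x + 2) (env 15) (by simp) (by simp [e15]) (Runs.block_nil ?_)
  exact (((h.setReg_scratch (by omega)).setReg_scratch (by omega)).setReg_scratch
    (by omega)).setMem h14 _ _

/-- The simulation is faithful and takes at most `8` steps for each simulated one. -/
theorem Represents.runs_simulate (he : Exec w inp p V τ V') (hV : V.Bounded w)
    (hp : p.RegsBelow R) (h : Represents R inp env base V S) (hw : w + 3 ≤ w') (h4 : env 4 = 4)
    (h5 : env 5 = 2) (h6 : env 6 = 3) (h14 : env 14 ≤ 1) :
    Runs w' inp' p.simulate S (8 * τ) (Represents R inp env base V') := by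
  have hpow : 2 ^ w ≤ 2 ^ w' := Nat.pow_le_pow_right (by norm_num) (by omega)
  induction he generalizing S
  · exact (Runs.skip h).mono (by omega) fun _ => id
  · rename_i s x a ha
    exact (Runs.imm (by omega) (h.setReg x a)).mono (by omega) fun _ => id
  · rename_i s o x y z hlt
    have e : o.eval (S.reg (y + 32)) (S.reg (z + 32)) = o.eval (s.reg y) (s.reg z) := by
      rw [h.reg y hp.2.1, h.reg z hp.2.2]
    exact (Runs.calc (by omega) (by rw [e]; exact h.setReg x _)).mono (by omega) fun _ => id
  · rename_i s x y hlt
    exact (h.runs_read hV hw h4 h6 hp.2 hlt).mono (by omega) fun _ => id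
  · rename_i s x y
    exact (h.runs_load hV hw h4 h5 h14 hp.2).mono (by omega) fun _ => id
  · rename_i s x y
    exact (h.runs_store hV hw h4 h5 h14 hp.1 hp.2).mono (by omega) fun _ => id
  · rename_i p q s s' s'' τ τ' he₁ he₂ ih₁ ih₂
    rw [mul_add]
    exact Runs.seq ((ih₁ hV hp.1 h).mono le_rfl fun S' h' => ih₂ (he₁.bounded hV) hp.2 h')
  · rename_i x p q s s' τ hx he₁ ih
    have e := h.reg x hp.1
    exact (Runs.branch (fun _ => ih hV hp.2.1 h)
      (fun h0 => absurd (e.symm.trans h0) hx)).mono (by omega) fun _ => id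
  · rename_i x p q s s' τ hx he₁ ih
    have e := h.reg x hp.1
    exact (Runs.branch (fun h0 => absurd (e.trans hx) h0)
      (fun _ => ih hV hp.2.2 h)).mono (by omega) fun _ => id
  · rename_i x p s hx
    exact ⟨1, S, by omega, .loop_done _ _ _ ((h.reg x hp.1).trans hx), h⟩
  · rename_i x p s s' s'' τ τ' hx he₁ he₂ ih₁ ih₂
    obtain ⟨τ₁, S₁, ht₁, hS₁, h₁⟩ := ih₁ hV hp.2 h
    obtain ⟨τ₂, S₂, ht₂, hS₂, h₂⟩ := ih₂ (he₁.bounded hV) hp h₁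
    exact ⟨τ₁ + τ₂ + 1, S₂, by omega,
      .loop_step _ _ _ _ _ _ _ (by rwa [h.reg x hp.1]) hS₁ hS₂, h₂⟩

end
end WordRAM

/-! ### Partial assignments and formulas -/

/-- The literal with code `l` is true under the assignment given by the binary digits of `x`, and
its variable lies in the part `g` of the variables: those below `a` (`g = 1`), or the others
(`g = 0`). -/
def LiteralHolds (a g x l : ℕ) : Prop :=
  (if l / 2 < a then 1 else 0) = g ∧ (x >>> (l / 2)) % 2 = l % 2

instance (a g x l : ℕ) : Decidable (LiteralHolds a g x l) := by
  unfold LiteralHolds; infer_instance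

/-- One of the first `j` literals of clause number `c` of the encoded `k`-CNF formula `inp` holds
in the sense of `LiteralHolds`. -/
def ClauseHolds (inp : List ℕ) (k a g x c j : ℕ) : Prop :=
  ∃ i < j, LiteralHolds a g x (inp.getD (2 + k * c + i) 0)

instance (inp : List ℕ) (k a g x c j : ℕ) : Decidable (ClauseHolds inp k a g x c j) := by
  unfold ClauseHolds; infer_instance

theorem clauseHolds_succ {inp : List ℕ} {k a g x c j : ℕ} :
    ClauseHolds inp k a g x c (j + 1) ↔ ClauseHolds inp k a g x c j ∨
      LiteralHolds a g x (inp.getD (2 + k * c + j) 0) := by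
  simp only [ClauseHolds, Nat.lt_succ_iff_lt_or_eq, or_and_right, exists_or, exists_eq_left]

theorem literalHolds_encodeLiteral {N a g x : ℕ} (l : Literal N) :
    LiteralHolds a g x (encodeLiteral l) ↔
      (if (l.1 : ℕ) < a then 1 else 0) = g ∧ x.testBit l.1 = l.2 := by
  obtain ⟨v, b⟩ := l
  have h1 : encodeLiteral (v, b) / 2 = v := by
    unfold encodeLiteral; cases b
    · simp
    · simp; omega
  have h2 : encodeLiteral (v, b) % 2 = b.toNat := by
    unfold encodeLiteral; cases b <;> simp
  unfold LiteralHolds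
  rw [h1, h2, Nat.shiftRight_eq_div_pow, Nat.testBit_eq_decide_div_mod_eq]
  cases b <;> simp

theorem List.getD_flatMap_ofFn {α : Type*} {k : ℕ} (f : α → Fin k → ℕ) (L : List α) (c : ℕ)
    (hc : c < L.length) (i : Fin k) :
    (L.flatMap fun x => List.ofFn (f x)).getD (k * c + i) 0 = f L[c] i := by
  induction L generalizing c with
  | nil => simp at hc
  | cons y L ih =>
    rw [List.flatMap_cons]
    cases c with
    | zero =>
      rw [Nat.mul_zero, Nat.zero_add, List.getD_append _ _ _ _ (by simp)]
      simp
    | succ c =>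
      rw [List.getD_append_right _ _ _ _ (by simp; nlinarith)]
      rw [List.length_ofFn, show k * (c + 1) + (i : ℕ) - k = k * c + i by
        rw [Nat.mul_succ]; omega]
      simpa using ih c (by simpa using hc)

theorem getD_encodeFormula {k N : ℕ} (φ : List (KClause k N)) (c : ℕ) (hc : c < φ.length)
    (i : Fin k) : (encodeFormula φ).getD (2 + k * c + i) 0 = encodeLiteral (φ[c] i) := by
  unfold encodeFormula
  rw [show 2 + k * c + (i : ℕ) = k * c + i + 1 + 1 by ring, List.getD_cons_succ,
    List.getD_cons_succ]
  exact List.getD_flatMap_ofFn (fun cl i => encodeLiteral (cl i)) φ c hc i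

theorem clauseHolds_encodeFormula {k N a g x c : ℕ} (φ : List (KClause k N)) (hc : c < φ.length) :
    ClauseHolds (encodeFormula φ) k a g x c k ↔
      ∃ i : Fin k, (if ((φ[c] i).1 : ℕ) < a then 1 else 0) = g ∧
        x.testBit (φ[c] i).1 = (φ[c] i).2 := by
  constructor
  · rintro ⟨i, hi, h⟩
    refine ⟨⟨i, hi⟩, ?_⟩
    rw [← literalHolds_encodeLiteral, ← getD_encodeFormula φ c hc]
    exact h
  · rintro ⟨i, h⟩
    refine ⟨i, i.2, ?_⟩
    rwa [getD_encodeFormula φ c hc, literalHolds_encodeLiteral]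

theorem getD_encodeFormula_lt {k N B : ℕ} (φ : List (KClause k N)) (hφ : φ.length < B)
    (hN : 2 * N + 1 < B) (y : ℕ) : (encodeFormula φ).getD y 0 < B := by
  have hall : ∀ v ∈ encodeFormula φ, v < B := by
    intro v hv
    simp only [encodeFormula, List.mem_cons, List.mem_flatMap, List.mem_ofFn] at hv
    obtain rfl | rfl | ⟨cl, -, i, rfl⟩ := hv
    · omega
    · exact hφ
    · have := (cl i).1.2
      unfold encodeLiteral
      split_ifs <;> omega
  by_cases hy : y < (encodeFormula φ).length
  · rw [List.getD_eq_getElem _ _ hy]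
    exact hall _ (List.getElem_mem hy)
  · rw [List.getD_eq_default _ _ (by omega)]
    omega

theorem length_le_of_nodup {k N : ℕ} {φ : List (KClause k N)} (h : φ.Nodup) :
    φ.length ≤ (2 * N) ^ k := by
  refine h.length_le_card.trans (le_of_eq ?_)
  simp [mul_comm]

/-- Every assignment splits into the digits below `a` of some `u` and the digits from `a` on of a
multiple of `2 ^ a`; here `u` may be chosen large, its higher digits being irrelevant. -/
theorem satisfiable_iff {k N a l : ℕ} (φ : List (KClause k N)) (ha : a ≤ N) (hal : a ≤ l)
    (hφ : φ.length + 2 ^ a < 2 ^ l) :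
    Satisfiable φ ↔ ∃ b < 2 ^ (N - a), ∃ u, φ.length < u ∧ u < 2 ^ l ∧ ∀ c < φ.length,
      ClauseHolds (encodeFormula φ) k a 1 u c k ∨
        ClauseHolds (encodeFormula φ) k a 0 (b <<< a) c k := by
  constructor
  · rintro ⟨σ, hσ⟩
    set X := Nat.ofBits σ with hX
    have hbit : ∀ v : Fin N, X.testBit v = σ v := fun v => Nat.testBit_ofBits_lt σ v v.2
    have hXN : X < 2 ^ N := Nat.ofBits_lt_two_pow σ
    have hlow : X % 2 ^ a < 2 ^ a := Nat.mod_lt _ (by positivity)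
    -- the last vertex whose number has the same digits below `a` as `X`
    refine ⟨X / 2 ^ a, ?_, X % 2 ^ a + (2 ^ l - 2 ^ a), by omega, by omega, fun c hc => ?_⟩
    · rw [Nat.div_lt_iff_lt_mul (by positivity), ← pow_add]
      rwa [Nat.sub_add_cancel ha]
    · obtain ⟨i, hi⟩ := hσ φ[c] (List.getElem_mem hc)
      rw [clauseHolds_encodeFormula φ hc, clauseHolds_encodeFormula φ hc]
      by_cases hv : ((φ[c] i).1 : ℕ) < a
      · refine Or.inl ⟨i, by simp [hv], ?_⟩
        have e : 2 ^ l - 2 ^ a = 2 ^ a * (2 ^ (l - a) - 1) := by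
          rw [Nat.mul_sub, ← pow_add, Nat.add_sub_cancel' hal, mul_one]
        rw [e, add_comm, Nat.testBit_two_pow_mul_add _ hlow, if_pos hv,
          Nat.testBit_mod_two_pow]
        simp [hv, hbit, hi]
      · refine Or.inr ⟨i, by simp [hv], ?_⟩
        rw [Nat.testBit_shiftLeft, Nat.testBit_div_two_pow,
          Nat.sub_add_cancel (not_lt.mp hv), hbit, hi]
        simp [not_lt.mp hv]
  · rintro ⟨b, -, u, -, -, h⟩
    refine ⟨fun v => if (v : ℕ) < a then u.testBit v else (b <<< a).testBit v, fun cl hcl => ?_⟩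
    obtain ⟨c, hc, rfl⟩ := List.getElem_of_mem hcl
    have := h c hc
    rw [clauseHolds_encodeFormula φ hc, clauseHolds_encodeFormula φ hc] at this
    obtain ⟨i, h1, h2⟩ | ⟨i, h1, h2⟩ := this
    · refine ⟨i, ?_⟩
      have : ((φ[c] i).1 : ℕ) < a := by by_contra hh; simp [hh] at h1
      simp [this, h2]
    · refine ⟨i, ?_⟩
      have : ¬ ((φ[c] i).1 : ℕ) < a := by by_contra hh; simp [hh] at h1
      simp only [this, if_false]
      exact h2

/-! ### The graph of the reduction -/

section

variable (n m : ℕ) (E : ℕ → ℕ → Prop)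

/-- `c` is one of the first `m` vertices, `u` is not, and `u = m` or `E c u` holds. The first `m`
vertices stand for clauses, the vertex `m` is a hub, and the further vertices stand for partial
assignments, which are to be adjacent to the clauses that they do not satisfy. -/
def IsReductionEdge (c u : ℕ) : Prop := c < m ∧ m ≤ u ∧ (u = m ∨ E c u)

instance [∀ c u, Decidable (E c u)] (c u : ℕ) : Decidable (IsReductionEdge m E c u) := by
  unfold IsReductionEdge; infer_instance

/-- The graph on `n` vertices with the edges given by `IsReductionEdge`. -/
def reductionGraph : SimpleGraph (Fin n) where
  Adj u v := IsReductionEdge m E u v ∨ IsReductionEdge m E v u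
  symm := ⟨fun _ _ h => h.symm⟩
  loopless := ⟨fun u h => by obtain ⟨h1, h2, -⟩ | ⟨h1, h2, -⟩ := h <;> omega⟩

/-- The numbers `m * u + c` below `Z` that encode edges `(c, u)` of the reduction graph. -/
def edgeCodes [∀ c u, Decidable (E c u)] (Z : ℕ) : List ℕ :=
  (List.range Z).filter fun z => IsReductionEdge m E (z % m) (z / m)

/-- The edge list of the reduction graph. -/
def reductionEdges [∀ c u, Decidable (E c u)] (hm : m ≤ n) : List (Fin n × Fin n) :=
  ((List.finRange (n * m)).filter fun z : Fin (n * m) =>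
    IsReductionEdge m E ((z : ℕ) % m) ((z : ℕ) / m)).map
      fun z : Fin (n * m) => (Fin.castLE hm z.modNat, z.divNat)

variable {n m E}

theorem isEdgeList_reductionEdges [∀ c u, Decidable (E c u)] (hm : m ≤ n) :
    IsEdgeList (reductionGraph n m E) (reductionEdges n m E hm) := by
  constructor
  · refine List.Nodup.map_on ?_ ((List.nodup_finRange _).filter _)
    intro z _ z' _ h
    simp only [Prod.mk.injEq, Fin.ext_iff, Fin.val_castLE, Fin.coe_modNat, Fin.coe_divNat] at h
    apply Fin.ext
    rw [← Nat.div_add_mod (z : ℕ) m, ← Nat.div_add_mod (z' : ℕ) m, h.1, h.2]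
  · intro c u
    simp only [reductionEdges, List.mem_map, List.mem_filter, List.mem_finRange, true_and,
      decide_eq_true_eq, Prod.mk.injEq, reductionGraph]
    constructor
    · rintro ⟨z, hz, rfl, rfl⟩
      exact ⟨Fin.lt_def.mpr (by simpa using lt_of_lt_of_le hz.1 hz.2.1), Or.inl hz⟩
    · rintro ⟨hlt, h | h⟩
      · have hc := h.1
        have hz : m * u + c < n * m := by
          have : m * (u + 1) ≤ m * n := Nat.mul_le_mul_left m u.2
          rw [mul_comm n]
          rw [mul_add] at this
          omega
        have e1 : (m * u + c) / m = u := by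
          rw [Nat.mul_add_div (by omega), Nat.div_eq_of_lt hc, add_zero]
        have e2 : (m * (u : ℕ) + c) % m = c := by
          rw [Nat.mul_add_mod, Nat.mod_eq_of_lt hc]
        refine ⟨⟨m * u + c, hz⟩, ?_, ?_, ?_⟩
        · simpa only [e1, e2] using h
        · simp [Fin.ext_iff, e2]
        · simp [Fin.ext_iff, e1]
      · exact absurd hlt (not_lt.mpr (Fin.le_def.mpr (h.1.le.trans h.2.1)))

theorem encodeGraph_reductionEdges [∀ c u, Decidable (E c u)] (hm : m ≤ n) (d : ℕ) :
    encodeGraph n d (reductionEdges n m E hm) =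
      [n, (edgeCodes m E (n * m)).length, d] ++
        (edgeCodes m E (n * m)).flatMap fun z => [z % m, z / m] := by
  have h : edgeCodes m E (n * m) = ((List.finRange (n * m)).filter
      fun z : Fin (n * m) => IsReductionEdge m E ((z : ℕ) % m) ((z : ℕ) / m)).map
        fun z : Fin (n * m) => (z : ℕ) := by
    rw [edgeCodes, ← List.map_coe_finRange_eq_range, List.filter_map]
    rfl
  rw [h]
  simp [encodeGraph, reductionEdges, List.flatMap_map]

/-- After the deletion of some of the first `m` vertices, the reduction graph is connected iff each
of the vertices after the hub keeps a neighbor: the other remaining vertices are joined to the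
hub. -/
theorem connected_reductionGraph_iff (hm : m < n) (D : List (Fin n)) (hD : ∀ v ∈ D, (v : ℕ) < m) :
    ((reductionGraph n m E).induce {v : Fin n | v ∉ D}).Connected ↔
      ∀ u : Fin n, m < u → ∃ c : Fin n, (c : ℕ) < m ∧ c ∉ D ∧ E c u := by
  have hub : (⟨m, hm⟩ : Fin n) ∉ D := fun h => lt_irrefl _ (hD _ h)
  constructor
  · -- without a remaining neighbor, `u` would be isolated, and it is not the only vertex
    intro hc u hu
    have huD : u ∉ D := fun h => lt_asymm (hD _ h) hu
    have : Nontrivial {v : Fin n | v ∉ D} :=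
      ⟨⟨⟨u, huD⟩, ⟨⟨m, hm⟩, hub⟩, fun h => by
        have := congrArg Fin.val (congrArg Subtype.val h)
        simp only at this; omega⟩⟩
    obtain ⟨c, hcu⟩ := hc.preconnected.exists_adj_of_nontrivial ⟨u, huD⟩
    have hadj : (reductionGraph n m E).Adj u c := hcu
    obtain h | h := hadj
    · exact absurd h.1 (by omega)
    · refine ⟨c, h.1, c.2, ?_⟩
      obtain h' | h' := h.2.2
      · omega
      · exact h'
  · intro h
    have hclause : ∀ c : {v : Fin n | v ∉ D}, ((c : Fin n) : ℕ) < m →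
        ((reductionGraph n m E).induce {v : Fin n | v ∉ D}).Reachable c ⟨⟨m, hm⟩, hub⟩ :=
      fun c hc => SimpleGraph.Adj.reachable
        (show (reductionGraph n m E).Adj c ⟨m, hm⟩ from Or.inl ⟨hc, le_rfl, Or.inl rfl⟩)
    have hall : ∀ v : {v : Fin n | v ∉ D},
        ((reductionGraph n m E).induce {v : Fin n | v ∉ D}).Reachable v ⟨⟨m, hm⟩, hub⟩ := by
      intro v
      obtain hv | hv | hv := lt_trichotomy ((v : Fin n) : ℕ) m
      · exact hclause v hv
      · have : v = ⟨⟨m, hm⟩, hub⟩ := Subtype.ext (Fin.ext hv)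
        rw [this]
      · obtain ⟨c, hc, hcD, hE⟩ := h v hv
        have hadj : ((reductionGraph n m E).induce {v : Fin n | v ∉ D}).Adj v ⟨c, hcD⟩ :=
          show (reductionGraph n m E).Adj v c from Or.inr ⟨hc, hv.le, Or.inr hE⟩
        exact hadj.reachable.trans (hclause ⟨c, hcD⟩ hc)
    have : Nonempty {v : Fin n | v ∉ D} := ⟨⟨⟨m, hm⟩, hub⟩⟩
    exact ⟨fun v v' => (hall v).trans (hall v').symm⟩

end

/-- The failed vertices: those of the first `m` vertices that satisfy `F`. -/
def failures (n m : ℕ) (F : ℕ → Prop) [DecidablePred F] (hm : m ≤ n) : List (Fin n) :=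
  ((List.finRange m).filter fun c : Fin m => F c).map (Fin.castLE hm)

section

variable {n m : ℕ} {F : ℕ → Prop} [DecidablePred F]

theorem nodup_failures (hm : m ≤ n) : (failures n m F hm).Nodup :=
  ((List.nodup_finRange _).filter _).map (Fin.castLE_injective hm)

theorem mem_failures (hm : m ≤ n) {v : Fin n} :
    v ∈ failures n m F hm ↔ (v : ℕ) < m ∧ F v := by
  simp only [failures, List.mem_map, List.mem_filter, List.mem_finRange, true_and,
    decide_eq_true_eq]
  constructor
  · rintro ⟨c, hc, rfl⟩
    exact ⟨c.2, hc⟩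
  · rintro ⟨hv, hF⟩
    exact ⟨⟨v, hv⟩, hF, rfl⟩

theorem encodeFailures_failures (hm : m ≤ n) :
    encodeFailures (failures n m F hm) =
      ((List.range m).filter fun c => F c).length :: (List.range m).filter fun c => F c := by
  have h : ((List.range m).filter fun c => F c) =
      ((List.finRange m).filter fun c : Fin m => F c).map fun c : Fin m => (c : ℕ) := by
    rw [← List.map_coe_finRange_eq_range, List.filter_map]
    rfl
  rw [h]
  simp [encodeFailures, failures, List.flatMap_map, ← List.map_eq_flatMap]

theorem length_failures_le (hm : m ≤ n) : (failures n m F hm).length ≤ m := by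
  rw [failures, List.length_map]
  exact (List.length_filter_le _ _).trans (by simp)

end

/-- The formula is satisfiable iff one of the deletions disconnects the reduction graph. -/
theorem satisfiable_iff_not_connected {k N a l : ℕ} (φ : List (KClause k N)) (ha : a ≤ N)
    (hal : a ≤ l) (hφ : φ.length + 2 ^ a < 2 ^ l) (hm : φ.length ≤ 2 ^ l) :
    Satisfiable φ ↔ ∃ b < 2 ^ (N - a), ¬ ((reductionGraph (2 ^ l) φ.length
      fun c u => ¬ ClauseHolds (encodeFormula φ) k a 1 u c k).induce
        {v | v ∉ failures (2 ^ l) φ.length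
          (fun c => ClauseHolds (encodeFormula φ) k a 0 (b <<< a) c k) hm}).Connected := by
  rw [satisfiable_iff φ ha hal hφ]
  refine exists_congr fun b => and_congr_right fun _ => ?_
  have := Nat.two_pow_pos a
  rw [connected_reductionGraph_iff (by omega) _ fun v hv => ((mem_failures hm).mp hv).1]
  push Not
  constructor
  · rintro ⟨u, hu, hul, h⟩
    refine ⟨⟨u, hul⟩, hu, fun c hc hcD => ?_⟩
    rw [mem_failures] at hcD
    exact (h c hc).resolve_right fun h' => hcD ⟨hc, h'⟩
  · rintro ⟨u, hu, h⟩
    refine ⟨u, hu, u.2, fun c hc => ?_⟩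
    by_cases h0 : ClauseHolds (encodeFormula φ) k a 0 (b <<< a) c k
    · exact Or.inr h0
    · exact Or.inl (h ⟨c, hc.trans_le hm⟩ hc fun hD => h0 ((mem_failures hm).mp hD).2)

/-! ### Subroutines of the reduction -/

namespace WordRAM

/-- The registers of the reduction. The registers `4` to `12` hold small constants and the
parameters of the reduction: the number `N` of variables, the number `m` of clauses, the number
`a` of variables in the first part, `l`, and the number `2 ^ l` of vertices. Of the other
registers below `32`, those up to `3` and from `24` to `28` are scratch, `13` holds the bound on
the number of failures, `14` to `16` control `Prog.simulate`, `17` and `18` are the counter and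
the bound of the outer loops, `19` is the number of the current clause, `20` the test register of
all loops, `21` the current assignment, `22` the part of the variables under consideration, `23`
the result of a clause check, and `29` counts the queries that found the graph disconnected. -/
structure Params (N m a l : ℕ) (r : ℕ → ℕ) : Prop where
  r4 : r 4 = 4
  r5 : r 5 = 2
  r6 : r 6 = 3
  r7 : r 7 = 1
  r8 : r 8 = N
  r9 : r 9 = m
  r10 : r 10 = a
  r11 : r 11 = l
  r12 : r 12 = 2 ^ l

theorem Params.congr {N m a l : ℕ} {r r' : ℕ → ℕ} (h : Params N m a l r)
    (hr : ∀ x, 4 ≤ x → x ≤ 12 → r' x = r x) : Params N m a l r' where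
  r4 := (hr 4 (by omega) (by omega)).trans h.r4
  r5 := (hr 5 (by omega) (by omega)).trans h.r5
  r6 := (hr 6 (by omega) (by omega)).trans h.r6
  r7 := (hr 7 (by omega) (by omega)).trans h.r7
  r8 := (hr 8 (by omega) (by omega)).trans h.r8
  r9 := (hr 9 (by omega) (by omega)).trans h.r9
  r10 := (hr 10 (by omega) (by omega)).trans h.r10
  r11 := (hr 11 (by omega) (by omega)).trans h.r11
  r12 := (hr 12 (by omega) (by omega)).trans h.r12

/-- All numbers occurring in the reduction fit into words of `w` bits. -/
structure Fits (k q K N m l w : ℕ) : Prop where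
  q_lt : q < 2 ^ w
  K_lt : K < 2 ^ w
  clause_lt : k * m + k + 2 < 2 ^ w
  literal_lt : 2 * N + 1 < 2 ^ w
  assignment_lt : 2 ^ N < 2 ^ w
  graph_lt : 16 * (2 ^ l * 2 ^ l) + 16 < 2 ^ w

/-- Test the literal at position `reg 24` of the input and add the result to `reg 23`. -/
def Prog.checkStep : Prog := .block
  [.read 25 24, .calc .add 24 24 7, .calc .div 26 25 5, .calc .mod 25 25 5, .calc .lt 27 26 10,
    .calc .eq 27 27 22, .calc .shr 28 21 26, .calc .mod 28 28 5, .calc .eq 28 28 25,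
    .calc .mul 27 27 28, .calc .add 23 23 27]

/-- `j` consecutive literal tests. -/
def Prog.checkSteps : ℕ → Prog
  | 0 => .skip
  | j + 1 => .seq (Prog.checkSteps j) Prog.checkStep

/-- Count in `reg 23` the literals of clause number `reg 19` that hold in the sense of
`LiteralHolds` for the part `reg 22` of the assignment `reg 21`. -/
def Prog.check (k : ℕ) : Prog := .block
  [.imm 24 k, .calc .mul 24 24 19, .calc .add 24 24 5, .imm 23 0, Prog.checkSteps k]

/-- Write register `r` at the end of the simulated input, whose length is `reg 16`. -/
def Prog.push (r : ℕ) : Prog := .block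
  [.calc .mul 1 16 4, .calc .add 1 1 6, .store 1 r, .calc .add 16 16 7]

/-- The simulated input, kept in the lane of the cells `4 * y + 3`, is `L`. -/
def State.HoldsTape (L : List ℕ) (s : State) : Prop :=
  s.reg 16 = L.length ∧ ∀ y < L.length, s.mem (4 * y + 3) = L.getD y 0

theorem State.HoldsTape.congr {L : List ℕ} {s s' : State} (h : s.HoldsTape L)
    (h16 : s'.reg 16 = s.reg 16) (hmem : s'.mem = s.mem) : s'.HoldsTape L :=
  ⟨h16.trans h.1, fun y hy => by rw [hmem]; exact h.2 y hy⟩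

/-- Clear the simulated registers below `R`. -/
def Prog.clear : ℕ → Prog
  | 0 => .skip
  | R + 1 => .seq (Prog.clear R) (.imm (R + 32) 0)

section

variable {k q K N m a l w : ℕ} {inp : List ℕ} {s : State}

theorem runs_clear (R : ℕ) : Runs w inp (.clear R) s (R + 1) fun s' =>
    s'.mem = s.mem ∧ (∀ x < R, s'.reg (x + 32) = 0) ∧ ∀ x < 32, s'.reg x = s.reg x := by
  induction R with
  | zero => exact Runs.skip ⟨rfl, by simp, fun _ _ => rfl⟩
  | succ R ih =>
    refine Runs.seq (ih.mono le_rfl ?_)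
    rintro s' ⟨h1, h2, h3⟩
    refine Runs.imm (by positivity) ⟨h1, fun x hx => ?_, fun x hx => ?_⟩
    · rw [State.setReg_reg]
      split_ifs
      · rfl
      · exact h2 x (by omega)
    · rw [State.setReg_reg, if_neg (by omega)]
      exact h3 x hx

theorem runs_push {L : List ℕ} {r : ℕ} (h4 : s.reg 4 = 4) (h6 : s.reg 6 = 3) (h7 : s.reg 7 = 1)
    (hL : s.HoldsTape L) (hr : r ≠ 1) (hw : 4 * L.length + 4 < 2 ^ w) :
    Runs w inp (.push r) s 5 fun s' => s'.HoldsTape (L ++ [s.reg r]) ∧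
      (∀ b, b % 4 ≠ 3 → s'.mem b = s.mem b) ∧ ∀ x, x ≠ 1 → x ≠ 16 → s'.reg x = s.reg x := by
  have h16 := hL.1
  refine Runs.block_calc (4 * L.length) (by simp [Op.eval, h16, h4, mul_comm]) (by omega) ?_
  refine Runs.block_calc (4 * L.length + 3) (by simp [Op.eval, h6]) (by omega) ?_
  refine Runs.block_store (4 * L.length + 3) (s.reg r) (by simp) (by simp [hr]) ?_
  refine Runs.block_calc (L.length + 1) (by simp [Op.eval, h7, h16]) (by omega) ?_
  refine Runs.block_nil ⟨⟨by simp, fun y hy => ?_⟩, fun b hb => ?_, fun x hx hx' => ?_⟩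
  · simp only [List.length_append, List.length_singleton] at hy
    simp only [State.setReg_mem, State.setMem_mem]
    by_cases hyL : y = L.length
    · subst hyL
      rw [if_pos rfl, List.getD_append_right _ _ _ _ le_rfl]
      simp
    · rw [if_neg (by omega), List.getD_append _ _ _ _ (by omega)]
      exact hL.2 y (by omega)
  · simp only [State.setReg_mem, State.setMem_mem]
    rw [if_neg (by omega)]
  · simp [hx, hx']

/-- The state after `j` steps of a clause check that started in `s`. -/
structure CheckInv (inp : List ℕ) (k a : ℕ) (s : State) (j : ℕ) (s' : State) : Prop where
  mem : s'.mem = s.mem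
  reg : ∀ x, x < 23 ∨ 28 < x → s'.reg x = s.reg x
  pos : s'.reg 24 = k * s.reg 19 + 2 + j
  le : s'.reg 23 ≤ j
  holds : s'.reg 23 ≠ 0 ↔ ClauseHolds inp k a (s.reg 22) (s.reg 21) (s.reg 19) j

theorem runs_checkStep (h : Params N m a l s.reg) {j : ℕ} {s' : State}
    (hs' : CheckInv inp k a s j s') (hw : w ≠ 0) (hpos : k * s.reg 19 + 2 + j + 1 < 2 ^ w)
    (hx : s.reg 21 < 2 ^ w) (hinp : ∀ y, inp.getD y 0 < 2 ^ w) :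
    Runs w inp .checkStep s' 12 (CheckInv inp k a s (j + 1)) := by
  have h1 : 1 < 2 ^ w := Nat.one_lt_two_pow hw
  have e5 := (hs'.reg 5 (by omega)).trans h.r5
  have e7 := (hs'.reg 7 (by omega)).trans h.r7
  have e10 := (hs'.reg 10 (by omega)).trans h.r10
  have e21 := hs'.reg 21 (by omega)
  have e22 := hs'.reg 22 (by omega)
  have e24 := hs'.pos
  have hle := hs'.le
  have hl := hinp (k * s.reg 19 + 2 + j)
  set lit := inp.getD (k * s.reg 19 + 2 + j) 0 with hlit
  set v₁ := if (if lit / 2 < a then 1 else 0) = s.reg 22 then 1 else 0 with hv₁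
  set v₂ := if (s.reg 21 >>> (lit / 2)) % 2 = lit % 2 then 1 else 0 with hv₂
  have hv1 : v₁ * v₂ ≤ 1 := by rw [hv₁, hv₂]; split_ifs <;> simp
  have hv0 : v₁ * v₂ ≠ 0 ↔ LiteralHolds a (s.reg 22) (s.reg 21) lit := by
    rw [hv₁, hv₂, LiteralHolds]
    by_cases h1 : (if lit / 2 < a then 1 else 0) = s.reg 22 <;>
      by_cases h2 : (s.reg 21 >>> (lit / 2)) % 2 = lit % 2 <;> simp only [h1, h2, if_true,
        if_false, and_true, and_false] <;> simp
  have hsh : s.reg 21 >>> (lit / 2) ≤ s.reg 21 := Nat.shiftRight_le _ _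
  have hdiv : lit / 2 ≤ lit := Nat.div_le_self _ _
  have hmod : ∀ u, u % 2 ≤ 1 := fun u => by omega
  refine Runs.block_read lit (by rw [e24]) hl ?_
  refine Runs.block_calc (k * s.reg 19 + 2 + j + 1) (by simp [Op.eval, e24, e7]) (by omega) ?_
  refine Runs.block_calc (lit / 2) (by simp [Op.eval, e5]) (by omega) ?_
  refine Runs.block_calc (lit % 2) (by simp [Op.eval, e5]) ((hmod _).trans_lt h1) ?_
  refine Runs.block_calc (if lit / 2 < a then 1 else 0) (by simp [Op.eval, e10])
    (by split_ifs <;> omega) ?_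
  refine Runs.block_calc v₁ (by simp [Op.eval, e22, hv₁]) (by rw [hv₁]; split_ifs <;> omega) ?_
  refine Runs.block_calc (s.reg 21 >>> (lit / 2)) (by simp [Op.eval, e21]) (by omega) ?_
  refine Runs.block_calc ((s.reg 21 >>> (lit / 2)) % 2) (by simp [Op.eval, e5])
    ((hmod _).trans_lt h1) ?_
  refine Runs.block_calc v₂ (by simp [Op.eval, hv₂]) (by rw [hv₂]; split_ifs <;> omega) ?_
  refine Runs.block_calc (v₁ * v₂) (by simp [Op.eval]) (by omega) ?_
  refine Runs.block_calc (s'.reg 23 + v₁ * v₂) (by simp [Op.eval]) (by omega) ?_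
  refine Runs.block_nil ⟨hs'.mem, fun x hx => ?_, ?_, ?_, ?_⟩
  · rw [← hs'.reg x hx]
    simp only [State.setReg_reg, show x ≠ 23 by omega, show x ≠ 24 by omega,
      show x ≠ 25 by omega, show x ≠ 26 by omega, show x ≠ 27 by omega, show x ≠ 28 by omega,
      if_false]
  · simp; omega
  · simp only [State.setReg_reg, if_true]; omega
  · rw [clauseHolds_succ, ← hs'.holds, add_comm 2, ← hlit, ← hv0]
    simp only [State.setReg_reg, if_true]
    omega

theorem runs_check (h : Params N m a l s.reg) (hf : Fits k q K N m l w) (hc : s.reg 19 < m)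
    (hx : s.reg 21 < 2 ^ w) (hinp : ∀ y, inp.getD y 0 < 2 ^ w) :
    Runs w inp (.check k) s (12 * k + 6) (CheckInv inp k a s k) := by
  have hB := hf.clause_lt
  have hw : w ≠ 0 := by rintro rfl; simp at hB
  have hkc : k * s.reg 19 ≤ k * m := Nat.mul_le_mul_left k hc.le
  have e5 := h.r5
  rw [show 12 * k + 6 = (12 * k + 1 + 1) + 1 + 1 + 1 + 1 by ring]
  refine Runs.block_imm (by omega) ?_
  refine Runs.block_calc (k * s.reg 19) (by simp [Op.eval]) (by omega) ?_
  refine Runs.block_calc (k * s.reg 19 + 2) (by simp [Op.eval, e5]) (by omega) ?_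
  refine Runs.block_imm (by omega) ?_
  refine Runs.block_cons (B' := 1) ?_
  refine Runs.mono (Q := CheckInv inp k a s k) ?_ le_rfl fun _ h => Runs.block_nil h
  have key : ∀ s₀, CheckInv inp k a s 0 s₀ → ∀ j ≤ k,
      Runs w inp (.checkSteps j) s₀ (12 * j + 1) (CheckInv inp k a s j) := by
    intro s₀ h₀ j
    induction j with
    | zero => exact fun _ => Runs.skip h₀
    | succ j ih =>
      intro hj
      rw [show 12 * (j + 1) + 1 = 12 * j + 1 + 12 by ring]
      exact Runs.seq ((ih (by omega)).mono le_rfl fun s' hs' =>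
        runs_checkStep h hs' hw (by omega) hx hinp)
  refine key _ ?_ k le_rfl
  refine ⟨rfl, fun x hx => ?_, ?_, ?_, ?_⟩
  · simp only [State.setReg_reg, show x ≠ 23 by omega, show x ≠ 24 by omega, if_false]
  · simp
  · simp
  · simp [ClauseHolds]

end

section

variable {k q K N m a l w : ℕ} {inp : List ℕ} {s : State}

theorem State.HoldsTape.setReg {L : List ℕ} (h : s.HoldsTape L) {x v : ℕ} (hx : x ≠ 16) :
    (s.setReg x v).HoldsTape L :=
  h.congr (by rw [State.setReg_reg, if_neg hx.symm]) rfl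

/-- Treat the number `reg 17 = m * u + c`: append `c` and `u` to the simulated input if `(c, u)` is
an edge of the reduction graph. -/
def Prog.edgeBody (k : ℕ) : Prog := .block
  [.calc .mod 19 17 9, .calc .div 21 17 9, .check k, .calc .eq 24 21 9, .calc .sub 25 7 23,
    .calc .add 24 24 25, .calc .lt 25 21 9, .calc .sub 25 7 25, .calc .mul 24 24 25,
    .branch 24 (.block [.push 19, .push 21]) .skip]

/-- The edge relation of the reduction: the assignment `u` to the variables below `a` satisfies no
literal of clause number `c`. -/
abbrev Violates (inp : List ℕ) (k a c u : ℕ) : Prop := ¬ ClauseHolds inp k a 1 u c k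

/-- The state after treating the numbers below `z`, if the loop was started in `s` with the
simulated input `H`. -/
structure EdgeInv (inp : List ℕ) (k a m : ℕ) (H : List ℕ) (s : State) (z : ℕ) (s' : State) :
    Prop where
  counter : s'.reg 17 = z
  reg : ∀ x, x ≠ 1 → x ≠ 16 → x ≠ 17 → x < 19 ∨ x = 22 ∨ 28 < x → s'.reg x = s.reg x
  tape : s'.HoldsTape (H ++ (edgeCodes m (Violates inp k a) z).flatMap fun z => [z % m, z / m])
  mem : ∀ b, b % 4 ≠ 3 → s'.mem b = s.mem b

theorem edgeCodes_succ {m : ℕ} {E : ℕ → ℕ → Prop} [∀ c u, Decidable (E c u)] (z : ℕ) :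
    edgeCodes m E (z + 1) =
      edgeCodes m E z ++ if IsReductionEdge m E (z % m) (z / m) then [z] else [] := by
  rw [edgeCodes, List.range_succ, List.filter_append]
  congr 1
  by_cases h : IsReductionEdge m E (z % m) (z / m) <;> simp [h]

theorem length_edgeCodes_le {m : ℕ} {E : ℕ → ℕ → Prop} [∀ c u, Decidable (E c u)] (z : ℕ) :
    (edgeCodes m E z).length ≤ z :=
  (List.length_filter_le _ _).trans (by simp)

theorem length_flatMap_pair (L : List ℕ) (f g : ℕ → ℕ) :
    (L.flatMap fun z => [f z, g z]).length = 2 * L.length := by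
  induction L with
  | nil => rfl
  | cons x L ih => simp [ih]; omega

theorem runs_edgeBody (h : Params N m a l s.reg) (hf : Fits k q K N m l w) (hm : m < 2 ^ l)
    (hinp : ∀ y, inp.getD y 0 < 2 ^ w) (h22 : s.reg 22 = 1) {H : List ℕ} (hH : H.length = 3)
    {z : ℕ} (hz : z < 2 ^ l * m) {s' : State} (hs' : EdgeInv inp k a m H s z s') :
    Runs w inp (.edgeBody k) s' (12 * k + 27) fun s'' => s''.reg 17 = z ∧ s''.reg 7 = 1 ∧
      EdgeInv inp k a m H s (z + 1) (s''.setReg 17 (z + 1)) := by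
  have hB := hf.graph_lt
  have hnm : 2 ^ l * m ≤ 2 ^ l * 2 ^ l := Nat.mul_le_mul_left _ hm.le
  have hm0 : 0 < m := Nat.pos_of_ne_zero (by rintro rfl; simp at hz)
  have hc : z % m < m := Nat.mod_lt _ hm0
  have hu : z / m ≤ z := Nat.div_le_self _ _
  have hlen := length_edgeCodes_le (m := m) (E := Violates inp k a) z
  have hmn : m ≤ 2 ^ l * 2 ^ l := hm.le.trans (Nat.le_mul_self _)
  have hp : Params N m a l s'.reg :=
    h.congr fun x h1 h2 => hs'.reg x (by omega) (by omega) (by omega) (by omega)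
  have e17 := hs'.counter
  have e9 := hp.r9
  have e22 : s'.reg 22 = 1 :=
    (hs'.reg 22 (by omega) (by omega) (by omega) (by omega)).trans h22
  rw [show 12 * k + 27 = (12 * k + 6 + (12 + 1 + 1 + 1 + 1 + 1 + 1 + 1)) + 1 + 1 by ring]
  refine Runs.block_calc (z % m) (by simp [Op.eval, e17, e9]) (by omega) ?_
  refine Runs.block_calc (z / m) (by simp [Op.eval, e17, e9]) (by omega) ?_
  set s₁ := (s'.setReg 19 (z % m)).setReg 21 (z / m) with hs₁
  have hp₁ : Params N m a l s₁.reg := hp.congr fun x h1 h2 => by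
    simp only [hs₁, State.setReg_reg, show x ≠ 19 by omega, show x ≠ 21 by omega, if_false]
  refine Runs.block_cons (B := 12 * k + 6) (B' := 12 + 1 + 1 + 1 + 1 + 1 + 1 + 1)
    ((runs_check hp₁ hf
    (by simpa [hs₁] using hc) (by simp [hs₁]; omega) hinp).mono le_rfl ?_)
  intro s₂ hs₂
  have hsat := hs₂.holds
  have hp₂ : Params N m a l s₂.reg := hp₁.congr fun x h1 h2 => hs₂.reg x (by omega)
  have e19 : s₂.reg 19 = z % m := by rw [hs₂.reg 19 (by omega)]; simp [hs₁]
  have e21 : s₂.reg 21 = z / m := by rw [hs₂.reg 21 (by omega)]; simp [hs₁]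
  have e9 := hp₂.r9
  have e7 := hp₂.r7
  have hv : s₁.reg 22 = 1 ∧ s₁.reg 21 = z / m ∧ s₁.reg 19 = z % m := by
    simp [hs₁, e22]
  rw [hv.1, hv.2.1, hv.2.2] at hsat
  have hreg₂ : ∀ x, x ≠ 1 → x ≠ 16 → x ≠ 17 → x < 19 ∨ x = 22 ∨ 28 < x →
      s₂.reg x = s.reg x := by
    intro x h1 h2 h3 h4
    rw [hs₂.reg x (by omega), hs₁, State.setReg_reg, State.setReg_reg,
      if_neg (by omega), if_neg (by omega)]
    exact hs'.reg x h1 h2 h3 h4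
  have htape₂ : s₂.HoldsTape
      (H ++ (edgeCodes m (Violates inp k a) z).flatMap fun z => [z % m, z / m]) :=
    hs'.tape.congr (by rw [hs₂.reg 16 (by omega)]; simp [hs₁]) hs₂.mem
  have hcnt₂ : s₂.reg 17 = z := by
    rw [hs₂.reg 17 (by omega)]; simpa [hs₁] using e17
  have hmem₂ : ∀ b, b % 4 ≠ 3 → s₂.mem b = s.mem b := by
    intro b hb; rw [hs₂.mem]; exact hs'.mem b hb
  set v₁ := if z / m = m then 1 else 0 with hv₁
  set v₂ := if z / m < m then 1 else 0 with hv₂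
  have hv₁' : v₁ ≤ 1 := by rw [hv₁]; split_ifs <;> simp
  have hv₂' : v₂ ≤ 1 := by rw [hv₂]; split_ifs <;> simp
  have hprod : (v₁ + (1 - s₂.reg 23)) * (1 - v₂) ≤ 2 * 1 :=
    Nat.mul_le_mul (by omega) (by omega)
  have hedge : (v₁ + (1 - s₂.reg 23)) * (1 - v₂) ≠ 0 ↔
      IsReductionEdge m (Violates inp k a) (z % m) (z / m) := by
    rw [IsReductionEdge, Violates, ← hsat, hv₁, hv₂]
    by_cases h1 : z / m = m
    · simp [h1, hc]
    · by_cases h2 : z / m < m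
      · simp [h2, h1]
      · simp only [h1, h2, if_false, hc, not_lt.mp h2, true_and, false_or]
        omega
  refine Runs.block_calc v₁ (by simp [Op.eval, e21, e9, hv₁]) (by omega) ?_
  refine Runs.block_calc (1 - s₂.reg 23) (by simp [Op.eval, e7]) (by omega) ?_
  refine Runs.block_calc (v₁ + (1 - s₂.reg 23)) (by simp [Op.eval]) (by omega) ?_
  refine Runs.block_calc v₂ (by simp [Op.eval, e21, e9, hv₂]) (by omega) ?_
  refine Runs.block_calc (1 - v₂) (by simp [Op.eval, e7]) (by omega) ?_
  refine Runs.block_calc ((v₁ + (1 - s₂.reg 23)) * (1 - v₂)) (by simp [Op.eval]) (by omega) ?_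
  set s₃ := (((((s₂.setReg 24 v₁).setReg 25 (1 - s₂.reg 23)).setReg 24
    (v₁ + (1 - s₂.reg 23))).setReg 25 v₂).setReg 25 (1 - v₂)).setReg 24
    ((v₁ + (1 - s₂.reg 23)) * (1 - v₂)) with hs₃
  have hreg₃ : ∀ x, x ≠ 24 → x ≠ 25 → s₃.reg x = s₂.reg x := by
    intro x h1 h2; simp [hs₃, h1, h2]
  have h24 : s₃.reg 24 = (v₁ + (1 - s₂.reg 23)) * (1 - v₂) := by simp [hs₃]
  have htape₃ := htape₂.congr (hreg₃ 16 (by omega) (by omega)) (show s₃.mem = s₂.mem from rfl)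
  have hp₃ : Params N m a l s₃.reg := hp₂.congr fun x h1 h2 => hreg₃ x (by omega) (by omega)
  refine Runs.block_cons (B := 12) (Runs.mono (Q := fun s'' => s''.reg 17 = z ∧ s''.reg 7 = 1 ∧
      EdgeInv inp k a m H s (z + 1) (s''.setReg 17 (z + 1))) ?_ le_rfl fun _ h => Runs.block_nil h)
  have hL : (H ++ (edgeCodes m (Violates inp k a) z).flatMap fun z => [z % m, z / m]).length
      ≤ 3 + 2 * z := by
    rw [List.length_append, length_flatMap_pair, hH]; omega
  refine Runs.branch (B := 11) (fun h0 => ?_) (fun h0 => ?_)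
  · rw [h24, hedge] at h0
    refine Runs.block_cons (B := 5) (B' := 6) ((runs_push hp₃.r4 hp₃.r6 hp₃.r7 htape₃
      (by omega) (by omega)).mono le_rfl ?_)
    rintro s₄ ⟨ht₄, hm₄, hr₄⟩
    have hp₄ : Params N m a l s₄.reg := hp₃.congr fun x h1 h2 => hr₄ x (by omega) (by omega)
    refine Runs.block_cons (B := 5) (B' := 1) ((runs_push hp₄.r4 hp₄.r6 hp₄.r7 ht₄
      (by omega) (by rw [List.length_append, List.length_singleton]; omega)).mono le_rfl ?_)
    rintro s₅ ⟨ht₅, hm₅, hr₅⟩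
    have hreg₅ : ∀ x, x ≠ 1 → x ≠ 16 → x ≠ 24 → x ≠ 25 → s₅.reg x = s₂.reg x := by
      intro x h1 h2 h3 h4
      rw [hr₅ x h1 h2, hr₄ x h1 h2, hreg₃ x h3 h4]
    refine Runs.block_nil ⟨?_, ?_, ?_, fun x h1 h2 h3 h4 => ?_, ?_, fun b hb => ?_⟩
    · rw [hreg₅ 17 (by omega) (by omega) (by omega) (by omega), hcnt₂]
    · rw [hreg₅ 7 (by omega) (by omega) (by omega) (by omega), e7]
    · simp
    · rw [State.setReg_reg, if_neg h3, hreg₅ x h1 h2 (by omega) (by omega)]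
      exact hreg₂ x h1 h2 h3 h4
    · refine State.HoldsTape.setReg ?_ (by omega)
      rw [edgeCodes_succ, if_pos h0]
      rw [hr₄ 21 (by omega) (by omega), hreg₃ 21 (by omega) (by omega), e21,
        hreg₃ 19 (by omega) (by omega), e19] at ht₅
      simpa using ht₅
    · rw [State.setReg_mem, hm₅ b hb, hm₄ b hb]
      exact hmem₂ b hb
  · have h0' : ¬ IsReductionEdge m (Violates inp k a) (z % m) (z / m) := by
      rw [← hedge, ← h24]; exact not_not.mpr h0
    refine (Runs.skip ⟨?_, ?_, ?_, fun x h1 h2 h3 h4 => ?_, ?_, fun b hb => ?_⟩).mono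
      (by omega) fun _ h => h
    · rw [hreg₃ 17 (by omega) (by omega), hcnt₂]
    · rw [hreg₃ 7 (by omega) (by omega), e7]
    · simp
    · rw [State.setReg_reg, if_neg h3, hreg₃ x (by omega) (by omega)]
      exact hreg₂ x h1 h2 h3 h4
    · refine State.HoldsTape.setReg ?_ (by omega)
      rw [edgeCodes_succ, if_neg h0', List.append_nil]
      exact htape₃
    · exact hmem₂ b hb

/-- The counter runs through all pairs `(c, u)` with `c < m` and `u < 2 ^ l`, in the form
`m * u + c`. -/
theorem runs_edgeLoop (h : Params N m a l s.reg) (hf : Fits k q K N m l w) (hm : m < 2 ^ l)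
    (hinp : ∀ y, inp.getD y 0 < 2 ^ w) (h22 : s.reg 22 = 1) {H : List ℕ} (hH : H.length = 3)
    (hT : s.HoldsTape H) (h17 : s.reg 17 = 0) (h18 : s.reg 18 = 2 ^ l * m) :
    Runs w inp (.forLoop 17 18 20 7 (.edgeBody k)) s (2 ^ l * m * (12 * k + 30) + 2)
      (EdgeInv inp k a m H s (2 ^ l * m)) := by
  have hB := hf.graph_lt
  have hw : w ≠ 0 := by rintro rfl; simp at hB
  have hnm : 2 ^ l * m ≤ 2 ^ l * 2 ^ l := Nat.mul_le_mul_left _ hm.le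
  refine Runs.forLoop (C := 12 * k + 27) hw (by omega) (fun z s' hs' => ⟨hs'.counter, ?_⟩)
    (fun z s' v hs' => ?_)
    (fun z s' hz hs' => runs_edgeBody h hf hm hinp h22 hH hz hs') ?_
  · rw [hs'.reg 18 (by omega) (by omega) (by omega) (by omega), h18]
  · refine ⟨by simpa using hs'.counter, fun x h1 h2 h3 h4 => ?_, hs'.tape.setReg (by omega),
      hs'.mem⟩
    rw [State.setReg_reg, if_neg (by omega)]
    exact hs'.reg x h1 h2 h3 h4
  · exact ⟨h17, fun _ _ _ _ _ => rfl, by simpa [edgeCodes] using hT, fun _ _ => rfl⟩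

/-- Append the clause number `reg 19` to the simulated input if the clause is satisfied. -/
def Prog.failureBody (k : ℕ) : Prog := .block [.check k, .branch 23 (.push 19) .skip]

/-- The state after treating the clauses below `c`, if the loop was started in `s` with the
simulated input `H`. -/
structure FailureInv (inp : List ℕ) (k a : ℕ) (H : List ℕ) (s : State) (c : ℕ) (s' : State) :
    Prop where
  counter : s'.reg 19 = c
  reg : ∀ x, x ≠ 1 → x ≠ 16 → x ≠ 19 → x ≠ 20 → x < 23 ∨ 28 < x → s'.reg x = s.reg x
  tape : s'.HoldsTape
    (H ++ (List.range c).filter fun c => ClauseHolds inp k a 0 (s.reg 21) c k)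
  mem : ∀ b, b % 4 ≠ 3 → s'.mem b = s.mem b

theorem runs_failureLoop (h : Params N m a l s.reg) (hf : Fits k q K N m l w) (hm : m < 2 ^ l)
    (hinp : ∀ y, inp.getD y 0 < 2 ^ w) (h22 : s.reg 22 = 0) (hx : s.reg 21 < 2 ^ w) {H : List ℕ}
    (hH : H.length = 1) (hT : s.HoldsTape H) (h19 : s.reg 19 = 0) :
    Runs w inp (.forLoop 19 9 20 7 (.failureBody k)) s (m * (12 * k + 16) + 2)
      (FailureInv inp k a H s m) := by
  have hB := hf.graph_lt
  have hw : w ≠ 0 := by rintro rfl; simp at hB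
  have hmn : m ≤ 2 ^ l * 2 ^ l := hm.le.trans (Nat.le_mul_self _)
  refine Runs.forLoop (C := 12 * k + 13) hw (by omega) (fun c s' hs' => ⟨hs'.counter, ?_⟩)
    (fun c s' v hs' => ?_) (fun c s' hc hs' => ?_) ?_
  · rw [hs'.reg 9 (by omega) (by omega) (by omega) (by omega) (by omega), h.r9]
  · refine ⟨by simpa using hs'.counter, fun x h1 h2 h3 h4 h5 => ?_, hs'.tape.setReg (by omega),
      hs'.mem⟩
    rw [State.setReg_reg, if_neg h4]
    exact hs'.reg x h1 h2 h3 h4 h5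
  · have hp : Params N m a l s'.reg :=
      h.congr fun x h1 h2 => hs'.reg x (by omega) (by omega) (by omega) (by omega) (by omega)
    have e19 := hs'.counter
    have e21 : s'.reg 21 = s.reg 21 :=
      hs'.reg 21 (by omega) (by omega) (by omega) (by omega) (by omega)
    have e22 : s'.reg 22 = 0 :=
      (hs'.reg 22 (by omega) (by omega) (by omega) (by omega) (by omega)).trans h22
    rw [show 12 * k + 13 = 12 * k + 6 + (6 + 1) by ring]
    refine Runs.block_cons ((runs_check hp hf (by omega) (by omega) hinp).mono le_rfl ?_)
    intro s₁ hs₁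
    have hsat := hs₁.holds
    rw [e22, e21, e19] at hsat
    have hp₁ : Params N m a l s₁.reg := hp.congr fun x h1 h2 => hs₁.reg x (by omega)
    have htape₁ := hs'.tape.congr (hs₁.reg 16 (by omega)) hs₁.mem
    have hreg₁ : ∀ x, x ≠ 1 → x ≠ 16 → x ≠ 19 → x ≠ 20 → x < 23 ∨ 28 < x →
        s₁.reg x = s.reg x := fun x h1 h2 h3 h4 h5 => by
      rw [hs₁.reg x h5]; exact hs'.reg x h1 h2 h3 h4 h5
    have e19' : s₁.reg 19 = c := (hs₁.reg 19 (by omega)).trans e19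
    have hfil : ((List.range (c + 1)).filter fun c => ClauseHolds inp k a 0 (s.reg 21) c k) =
        ((List.range c).filter fun c => ClauseHolds inp k a 0 (s.reg 21) c k) ++
          if ClauseHolds inp k a 0 (s.reg 21) c k then [c] else [] := by
      rw [List.range_succ, List.filter_append]
      congr 1
      by_cases h : ClauseHolds inp k a 0 (s.reg 21) c k <;> simp [h]
    have hlen : ((List.range c).filter
        fun c => ClauseHolds inp k a 0 (s.reg 21) c k).length ≤ c :=
      (List.length_filter_le _ _).trans (by simp)
    refine Runs.block_cons (B := 6) (Runs.mono (Q := fun s'' => s''.reg 19 = c ∧ s''.reg 7 = 1 ∧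
      FailureInv inp k a H s (c + 1) (s''.setReg 19 (c + 1))) ?_ le_rfl fun _ h => Runs.block_nil h)
    refine Runs.branch (B := 5) (fun h0 => ?_) (fun h0 => ?_)
    · refine (runs_push hp₁.r4 hp₁.r6 hp₁.r7 htape₁ (by omega) ?_).mono le_rfl ?_
      · rw [List.length_append, hH]; omega
      rintro s₂ ⟨ht₂, hm₂, hr₂⟩
      refine ⟨?_, ?_, ?_, fun x h1 h2 h3 h4 h5 => ?_, ?_, fun b hb => ?_⟩
      · rw [hr₂ 19 (by omega) (by omega), e19']
      · rw [hr₂ 7 (by omega) (by omega), hp₁.r7]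
      · simp
      · rw [State.setReg_reg, if_neg h3, hr₂ x h1 h2, hreg₁ x h1 h2 h3 h4 h5]
      · refine State.HoldsTape.setReg ?_ (by omega)
        rw [hfil, if_pos (hsat.mp h0), ← List.append_assoc]
        rwa [e19'] at ht₂
      · rw [State.setReg_mem, hm₂ b hb, hs₁.mem]; exact hs'.mem b hb
    · refine (Runs.skip ⟨e19', hp₁.r7, ?_, fun x h1 h2 h3 h4 h5 => ?_, ?_,
        fun b hb => ?_⟩).mono (by omega) fun _ h => h
      · simp
      · rw [State.setReg_reg, if_neg h3, hreg₁ x h1 h2 h3 h4 h5]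
      · refine State.HoldsTape.setReg ?_ (by omega)
        rw [hfil, if_neg (fun h' => hsat.mpr h' h0), List.append_nil]
        exact htape₁
      · rw [State.setReg_mem, hs₁.mem]; exact hs'.mem b hb
  · exact ⟨h19, fun _ _ _ _ _ _ => rfl, by simpa using hT, fun _ _ => rfl⟩

end

end WordRAM

/-! ### The reduction -/

namespace WordRAM

/-- Add `1` to `reg 13` if the square of the result is at most `reg 11`. -/
def Prog.sqrtBody : Prog := .block
  [.calc .add 1 13 7, .calc .mul 1 1 1, .calc .lt 1 11 1, .calc .sub 1 7 1, .calc .add 13 13 1]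

/-- Load the parameters of the reduction and compute the bound `2 ^ √l` on the number of failures,
in `reg 13`. -/
def Prog.setup (q K : ℕ) : Prog := .block
  [.imm 4 4, .imm 5 2, .imm 6 3, .imm 7 1, .read 8 0, .read 9 7, .imm 1 q, .calc .div 10 8 1,
    .imm 1 K, .calc .add 11 10 1, .calc .shl 12 7 11, .forLoop 17 11 20 7 .sqrtBody,
    .calc .shl 13 7 13]

/-- Write the encoding of the reduction graph; its second entry, the number of edges, is filled in
at the end. -/
def Prog.buildGraph (k : ℕ) : Prog := .block
  [.push 12, .push 12, .push 13, .imm 17 0, .calc .mul 18 12 9, .imm 22 1,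
    .forLoop 17 18 20 7 (.edgeBody k), .calc .sub 1 16 6, .calc .div 1 1 5, .imm 2 7, .store 2 1]

/-- Write the failures for the assignment number `reg 17` to the second part of the variables, run
the update program `Q` on them, and increase `reg 29` if it answers that the graph is not
connected. -/
def Prog.queryBody (k R : ℕ) (Q : Prog) : Prog := .block
  [.imm 16 0, .push 17, .calc .shl 21 17 10, .imm 19 0, .forLoop 19 9 20 7 (.failureBody k),
    .calc .sub 1 16 7, .imm 2 3, .store 2 1, .calc .add 15 17 7, .clear R, Q.simulate, .imm 1 0,
    .calc .eq 1 32 1, .calc .add 29 29 1]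

/-- The algorithm for `k`-SAT that uses the oracle with construction program `P` and update
program `Q`. -/
def Prog.solver (k q K R : ℕ) (P Q : Prog) : Prog := .block
  [.setup q K, .buildGraph k, P.simulate, .imm 14 1, .calc .sub 1 8 10, .calc .shl 18 7 1,
    .imm 17 0, .imm 22 0, .forLoop 17 18 20 7 (.queryBody k R Q), .imm 1 0, .calc .add 0 29 1]

section

variable {k q K N m a l w R : ℕ} {inp : List ℕ} {s : State}

/-- After `z` rounds of `Prog.sqrtBody`, started in `s`, the candidate for the square root of `l`
has been increased `z` times, or until it was reached. -/
structure SqrtInv (l : ℕ) (s : State) (z : ℕ) (s' : State) : Prop where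
  counter : s'.reg 17 = z
  value : s'.reg 13 = min z l.sqrt
  reg : ∀ x, x ≠ 1 → x ≠ 13 → x ≠ 17 → x ≠ 20 → s'.reg x = s.reg x
  mem : s'.mem = s.mem

theorem runs_sqrtLoop (h7 : s.reg 7 = 1) (h11 : s.reg 11 = l) (h13 : s.reg 13 = 0)
    (h17 : s.reg 17 = 0) (hw : (l + 1) * (l + 1) < 2 ^ w) :
    Runs w inp (.forLoop 17 11 20 7 .sqrtBody) s (l * 9 + 2) (SqrtInv l s l) := by
  have hw0 : w ≠ 0 := by rintro rfl; simp at hw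
  have hll : l + 1 ≤ (l + 1) * (l + 1) := Nat.le_mul_self _
  refine Runs.forLoop (C := 6) hw0 (by omega) (fun z s' hs' => ⟨hs'.counter, ?_⟩)
    (fun z s' v hs' => ⟨by simpa using hs'.counter, by simpa using hs'.value,
      fun x h1 h2 h3 h4 => ?_, hs'.mem⟩) (fun z s' hz hs' => ?_)
    ⟨h17, by simpa using h13, fun _ _ _ _ _ => rfl, rfl⟩
  · rw [hs'.reg 11 (by omega) (by omega) (by omega) (by omega), h11]
  · rw [State.setReg_reg, if_neg h4]; exact hs'.reg x h1 h2 h3 h4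
  · have e7 : s'.reg 7 = 1 :=
      (hs'.reg 7 (by omega) (by omega) (by omega) (by omega)).trans h7
    have e11 : s'.reg 11 = l :=
      (hs'.reg 11 (by omega) (by omega) (by omega) (by omega)).trans h11
    set r := min z l.sqrt with hr
    have e13 : s'.reg 13 = r := hs'.value
    have hrl : (r + 1) * (r + 1) ≤ (l + 1) * (l + 1) := Nat.mul_le_mul (by omega) (by omega)
    set v := if l < (r + 1) * (r + 1) then 1 else 0 with hv
    have hv1 : v ≤ 1 := by rw [hv]; split_ifs <;> simp
    have hnext : r + (1 - v) = min (z + 1) l.sqrt := by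
      rw [hv]
      split_ifs with hlt
      · rw [← Nat.sqrt_lt] at hlt
        omega
      · have : r + 1 ≤ l.sqrt := Nat.le_sqrt.mpr (not_lt.mp hlt)
        omega
    refine Runs.block_calc (r + 1) (by simp [Op.eval, e13, e7]) (by omega) ?_
    refine Runs.block_calc ((r + 1) * (r + 1)) (by simp [Op.eval]) (by omega) ?_
    refine Runs.block_calc v (by simp [Op.eval, e11, hv]) (by omega) ?_
    refine Runs.block_calc (1 - v) (by simp [Op.eval, e7]) (by omega) ?_
    refine Runs.block_calc (r + (1 - v)) (by simp [Op.eval, e13]) (by omega) ?_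
    refine Runs.block_nil ⟨by simpa using hs'.counter, by simpa using e7, by simp, ?_,
      fun x h1 h2 h3 h4 => ?_, hs'.mem⟩
    · simpa using hnext
    · simp [h1, h2, h3, hs'.reg x h1 h2 h3 h4]

theorem runs_setup (ha : N / q = a) (hl : a + K = l) (hf : Fits k q K N m l w) (hm : m < 2 ^ l)
    (hN : inp.getD 0 0 = N) (hm' : inp.getD 1 0 = m) :
    Runs w inp (.setup q K) .init (l * 9 + 15) fun s =>
      Params N m a l s.reg ∧ s.reg 13 = 2 ^ l.sqrt ∧
      (∀ x, 14 ≤ x → x ≠ 17 → x ≠ 20 → s.reg x = 0) ∧ ∀ b, s.mem b = 0 := by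
  have hB := hf.graph_lt
  have hq := hf.q_lt
  have hK := hf.K_lt
  have hlit := hf.literal_lt
  have hdiv : a ≤ N := ha.symm.trans_le <| Nat.div_le_self _ _
  have hl2 : l < 2 ^ l := Nat.lt_two_pow_self
  have hll : (l + 1) * (l + 1) ≤ 2 ^ l * 2 ^ l := Nat.mul_le_mul hl2 hl2
  have hn : 2 ^ l ≤ 2 ^ l * 2 ^ l := Nat.le_mul_self _
  rw [show l * 9 + 15 = (l * 9 + 2 + 2) + 1 + 1 + 1 + 1 + 1 + 1 + 1 + 1 + 1 + 1 + 1 by ring]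
  refine Runs.block_imm (by omega) ?_
  refine Runs.block_imm (by omega) ?_
  refine Runs.block_imm (by omega) ?_
  refine Runs.block_imm (by omega) ?_
  refine Runs.block_read N (by simpa [State.init] using hN) (by omega) ?_
  refine Runs.block_read m (by simpa using hm') (by omega) ?_
  refine Runs.block_imm (by omega) ?_
  refine Runs.block_calc a (by simp [Op.eval, ha]) (by omega) ?_
  refine Runs.block_imm (by omega) ?_
  refine Runs.block_calc l (by simp [Op.eval, hl]) (by omega) ?_
  refine Runs.block_calc (2 ^ l) (by simp [Op.eval, Nat.shiftLeft_eq]) (by omega) ?_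
  refine Runs.block_cons (B := l * 9 + 2) (B' := 2) ((runs_sqrtLoop (l := l) (by simp) (by simp)
    (by simp [State.init]) (by simp [State.init]) (by omega)).mono le_rfl ?_)
  intro s hs
  have hr := hs.reg
  have e13 : s.reg 13 = l.sqrt := by rw [hs.value, min_eq_right (Nat.sqrt_le_self l)]
  have e7 : s.reg 7 = 1 := by rw [hr 7 (by omega) (by omega) (by omega) (by omega)]; simp
  have hd : 2 ^ l.sqrt ≤ 2 ^ l := Nat.pow_le_pow_right (by norm_num) (Nat.sqrt_le_self l)
  refine Runs.block_calc (2 ^ l.sqrt) (by simp [Op.eval, e13, e7, Nat.shiftLeft_eq]) (by omega) ?_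
  refine Runs.block_nil ⟨Params.congr (r := s.reg) ?_ fun x h1 h2 => ?_, by simp,
    fun x h1 h2 h3 => ?_, fun b => ?_⟩
  · constructor <;> rw [hr _ (by omega) (by omega) (by omega) (by omega)] <;> simp
  · rw [State.setReg_reg, if_neg (by omega)]
  · rw [State.setReg_reg, if_neg (by omega), hr x (by omega) (by omega) h2 h3]
    simp only [State.setReg_reg]
    simp only [show x ≠ 1 by omega, show x ≠ 4 by omega, show x ≠ 5 by omega,
      show x ≠ 6 by omega, show x ≠ 7 by omega, show x ≠ 8 by omega, show x ≠ 9 by omega,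
      show x ≠ 10 by omega, show x ≠ 11 by omega, show x ≠ 12 by omega, if_false, State.init]
  · rw [State.setReg_mem, hs.mem]
    simp [State.init]

theorem State.HoldsTape.set {L : List ℕ} (h : s.HoldsTape L) (y v : ℕ) :
    (s.setMem (4 * y + 3) v).HoldsTape (L.set y v) := by
  refine ⟨by simpa using h.1, fun y' hy' => ?_⟩
  rw [List.length_set] at hy'
  rw [State.setMem_mem, List.getD_eq_getElem _ _ (by simpa using hy'), List.getElem_set]
  by_cases hyy : y = y'
  · rw [if_pos (by omega), if_pos hyy]
  · rw [if_neg (by omega), if_neg hyy, h.2 y' hy', List.getD_eq_getElem _ _ hy']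

theorem runs_buildGraph (h : Params N m a l s.reg) (hf : Fits k q K N m l w) (hm : m < 2 ^ l)
    (hinp : ∀ y, inp.getD y 0 < 2 ^ w) {d : ℕ} (h13 : s.reg 13 = d) (h16 : s.reg 16 = 0) :
    Runs w inp (.buildGraph k) s (2 ^ l * m * (12 * k + 30) + 25) fun s' =>
      s'.HoldsTape
        (encodeGraph (2 ^ l) d (reductionEdges (2 ^ l) m (Violates inp k a) hm.le)) ∧
      (∀ b, b % 4 ≠ 3 → s'.mem b = s.mem b) ∧
      ∀ x, x ≠ 1 → x ≠ 2 → x ≠ 16 → x ≠ 17 → x ≠ 18 → x ≠ 22 → x < 19 ∨ 28 < x →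
        s'.reg x = s.reg x := by
  have hB := hf.graph_lt
  have hnm : 2 ^ l * m ≤ 2 ^ l * 2 ^ l := Nat.mul_le_mul_left _ hm.le
  have hlen := length_edgeCodes_le (m := m) (E := Violates inp k a) (2 ^ l * m)
  have hT₀ : s.HoldsTape [] := ⟨h16, by simp⟩
  rw [show 2 ^ l * m * (12 * k + 30) + 25 =
    5 + (5 + (5 + ((2 ^ l * m * (12 * k + 30) + 2 + (1 + 1 + 1 + 1 + 1)) + 1 + 1 + 1))) by ring]
  refine Runs.block_cons ((runs_push h.r4 h.r6 h.r7 hT₀ (by omega) (by simp; omega)).mono le_rfl ?_)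
  rintro s₁ ⟨ht₁, hm₁, hr₁⟩
  have hp₁ : Params N m a l s₁.reg := h.congr fun x h1 h2 => hr₁ x (by omega) (by omega)
  refine Runs.block_cons ((runs_push hp₁.r4 hp₁.r6 hp₁.r7 ht₁ (by omega)
    (by simp; omega)).mono le_rfl ?_)
  rintro s₂ ⟨ht₂, hm₂, hr₂⟩
  have hp₂ : Params N m a l s₂.reg := hp₁.congr fun x h1 h2 => hr₂ x (by omega) (by omega)
  refine Runs.block_cons ((runs_push hp₂.r4 hp₂.r6 hp₂.r7 ht₂ (by omega)
    (by simp; omega)).mono le_rfl ?_)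
  rintro s₃ ⟨ht₃, hm₃, hr₃⟩
  have hp₃ : Params N m a l s₃.reg := hp₂.congr fun x h1 h2 => hr₃ x (by omega) (by omega)
  rw [hr₂ 13 (by omega) (by omega), hr₁ 13 (by omega) (by omega), h13, hp₁.r12, h.r12] at ht₃
  refine Runs.block_imm (by omega) ?_
  refine Runs.block_calc (2 ^ l * m) (by simp [Op.eval, hp₃.r12, hp₃.r9]) (by omega) ?_
  refine Runs.block_imm (by omega) ?_
  set s₄ := ((s₃.setReg 17 0).setReg 18 (2 ^ l * m)).setReg 22 1 with hs₄
  have hr₄ : ∀ x, x ≠ 17 → x ≠ 18 → x ≠ 22 → s₄.reg x = s₃.reg x := by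
    intro x h1 h2 h3; simp [hs₄, h1, h2, h3]
  have hp₄ : Params N m a l s₄.reg :=
    hp₃.congr fun x h1 h2 => hr₄ x (by omega) (by omega) (by omega)
  refine Runs.block_cons (B := 2 ^ l * m * (12 * k + 30) + 2) (B' := 1 + 1 + 1 + 1 + 1)
    ((runs_edgeLoop hp₄ hf hm hinp (by simp [hs₄])
    (H := [2 ^ l, 2 ^ l, d]) rfl (ht₃.congr (by simp [hs₄]) rfl) (by simp [hs₄])
    (by simp [hs₄])).mono le_rfl ?_)
  intro s₅ hs₅
  set C := edgeCodes m (Violates inp k a) (2 ^ l * m) with hC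
  have hr₅ : ∀ x, x ≠ 1 → x ≠ 16 → x ≠ 17 → x ≠ 18 → x ≠ 22 → x < 19 ∨ 28 < x →
      s₅.reg x = s.reg x := by
    intro x h1 h2 h3 h4 h5 h6
    rw [hs₅.reg x h1 h2 h3 (by omega), hr₄ x h3 h4 h5, hr₃ x h1 h2, hr₂ x h1 h2, hr₁ x h1 h2]
  have hp₅ : Params N m a l s₅.reg :=
    h.congr fun x h1 h2 => hr₅ x (by omega) (by omega) (by omega) (by omega) (by omega) (by omega)
  have e16 : s₅.reg 16 = 3 + 2 * C.length := by
    rw [hs₅.tape.1, List.length_append, length_flatMap_pair]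
    rfl
  refine Runs.block_calc (2 * C.length) (by simp [Op.eval, e16, hp₅.r6]) (by omega) ?_
  refine Runs.block_calc C.length (by simp [Op.eval, hp₅.r5]) (by omega) ?_
  refine Runs.block_imm (by omega) ?_
  refine Runs.block_store (4 * 1 + 3) C.length (by simp) (by simp) ?_
  refine Runs.block_nil ⟨?_, fun b hb => ?_, fun x h1 h2 h3 h4 h5 h6 h7 => ?_⟩
  · rw [encodeGraph_reductionEdges]
    have := (hs₅.tape.congr (s' := ((s₅.setReg 1 (2 * C.length)).setReg 1 C.length).setReg 2 7)
      (by simp) rfl).set 1 C.length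
    exact this
  · rw [State.setMem_mem, if_neg (by omega)]
    simp only [State.setReg_mem]
    rw [hs₅.mem b hb, ← hm₁ b hb, ← hm₂ b hb, ← hm₃ b hb]
    rfl
  · simp only [State.setMem_reg, State.setReg_reg, h1, h2, if_false]
    exact hr₅ x h1 h3 h4 h5 h6 h7

/-- The state before query number `z`: `base` is the data structure left by the construction, and
`disc b` says that query number `b` finds the graph disconnected. -/
structure QueryInv (N m a l : ℕ) (base : ℕ → ℕ) (disc : ℕ → Prop) (z : ℕ) (s : State) : Prop where
  counter : s.reg 17 = z
  params : Params N m a l s.reg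
  layer : s.reg 14 = 1
  bound : s.reg 18 = 2 ^ (N - a)
  part : s.reg 22 = 0
  found_le : s.reg 29 ≤ z
  found : s.reg 29 ≠ 0 ↔ ∃ b < z, disc b
  base : ∀ b, s.mem (4 * b) = base b
  stamp : ∀ b, s.mem (4 * b + 2) ≤ z

theorem QueryInv.congr {base : ℕ → ℕ} {disc : ℕ → Prop} {z : ℕ} {s' : State}
    (h : QueryInv N m a l base disc z s) (hmem : s'.mem = s.mem)
    (hreg : ∀ x, 4 ≤ x → x ≠ 20 → s'.reg x = s.reg x) : QueryInv N m a l base disc z s' where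
  counter := (hreg 17 (by omega) (by omega)).trans h.counter
  params := h.params.congr fun x h1 h2 => hreg x h1 (by omega)
  layer := (hreg 14 (by omega) (by omega)).trans h.layer
  bound := (hreg 18 (by omega) (by omega)).trans h.bound
  part := (hreg 22 (by omega) (by omega)).trans h.part
  found_le := (hreg 29 (by omega) (by omega)).trans_le h.found_le
  found := by rw [hreg 29 (by omega) (by omega)]; exact h.found
  base := by rw [hmem]; exact h.base
  stamp := by rw [hmem]; exact h.stamp

/-- The simulated input of a represented state, read off the tape. -/
theorem State.HoldsTape.getD_eq {L : List ℕ} (h : s.HoldsTape L) (y : ℕ) :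
    L.getD y 0 = if y < s.reg 16 then s.mem (4 * y + 3) else 0 := by
  rw [h.1]
  split_ifs with hy
  · exact (h.2 y hy).symm
  · exact List.getD_eq_default _ _ (by omega)

/-- Query number `z`: each query starts from the data structure `base` left by the construction,
because the writes of earlier queries carry older time stamps. -/
theorem runs_queryBody (hf : Fits k q K N m l w) (hm : m < 2 ^ l) (ha : a ≤ N)
    (hinp : ∀ y, inp.getD y 0 < 2 ^ w) {Q : Prog} (hQR : Q.RegsBelow R) (hR : 1 ≤ R) {w₀ tq : ℕ}
    (hw₀ : w₀ + 3 ≤ w) {base : ℕ → ℕ} (hbase : ∀ b, base b < 2 ^ w₀) {disc : ℕ → Prop}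
    {z : ℕ} (hz : z < 2 ^ (N - a))
    (hQ : ∃ (τ : ℕ) (V : State), τ ≤ tq ∧
      Exec w₀ (encodeFailures (failures (2 ^ l) m
        (fun c => ClauseHolds inp k a 0 (z <<< a) c k) hm.le)) Q ⟨fun _ => 0, base⟩ τ V ∧
      (V.reg 0 ≠ 0 ↔ ¬ disc z))
    (hs : QueryInv N m a l base disc z s) :
    Runs w inp (.queryBody k R Q) s (m * (12 * k + 16) + R + 8 * tq + 19) fun s' =>
      s'.reg 17 = z ∧ s'.reg 7 = 1 ∧
        QueryInv N m a l base disc (z + 1) (s'.setReg 17 (z + 1)) := by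
  have hB := hf.graph_lt
  have hmn : m ≤ 2 ^ l * 2 ^ l := hm.le.trans (Nat.le_mul_self _)
  have hN := hf.assignment_lt
  have hz' : z + 1 ≤ 2 ^ N := hz.trans_le (Nat.pow_le_pow_right (by norm_num) (Nat.sub_le _ _))
  have hx : z <<< a < 2 ^ N := by
    rw [Nat.shiftLeft_eq]
    calc z * 2 ^ a < 2 ^ (N - a) * 2 ^ a := Nat.mul_lt_mul_of_pos_right hz (by positivity)
      _ = 2 ^ N := by rw [← pow_add, Nat.sub_add_cancel ha]
  obtain ⟨τ, V, hτ, he, hV⟩ := hQ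
  have e17 := hs.counter
  have hp := hs.params
  rw [show m * (12 * k + 16) + R + 8 * tq + 19 =
    (5 + ((m * (12 * k + 16) + 2 + ((R + 1 + (8 * tq + (1 + 1 + 1 + 1))) + 1 + 1 + 1 + 1)) + 1
      + 1)) + 1 by ring]
  refine Runs.block_imm (by omega) ?_
  set s₁ := s.setReg 16 0 with hs₁
  have hr₁ : ∀ x, x ≠ 16 → s₁.reg x = s.reg x := by intro x h1; simp [hs₁, h1]
  have hp₁ : Params N m a l s₁.reg := hp.congr fun x h1 h2 => hr₁ x (by omega)
  refine Runs.block_cons (B := 5) ((runs_push hp₁.r4 hp₁.r6 hp₁.r7 (L := [])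
    ⟨by simp [hs₁], by simp⟩ (by omega) (by simp; omega)).mono le_rfl ?_)
  rintro s₂ ⟨ht₂, hm₂, hr₂⟩
  have hp₂ : Params N m a l s₂.reg := hp₁.congr fun x h1 h2 => hr₂ x (by omega) (by omega)
  have e17₂ : s₂.reg 17 = z := by rw [hr₂ 17 (by omega) (by omega), hr₁ 17 (by omega), e17]
  refine Runs.block_calc (z <<< a) (by simp [Op.eval, e17₂, hp₂.r10]) (by omega) ?_
  refine Runs.block_imm (by omega) ?_
  set s₃ := (s₂.setReg 21 (z <<< a)).setReg 19 0 with hs₃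
  have hr₃ : ∀ x, x ≠ 21 → x ≠ 19 → s₃.reg x = s₂.reg x := by
    intro x h1 h2; simp [hs₃, h1, h2]
  have hp₃ : Params N m a l s₃.reg := hp₂.congr fun x h1 h2 => hr₃ x (by omega) (by omega)
  have e22₃ : s₃.reg 22 = 0 := by
    rw [hr₃ 22 (by omega) (by omega), hr₂ 22 (by omega) (by omega), hr₁ 22 (by omega), hs.part]
  have e21₃ : s₃.reg 21 = z <<< a := by simp [hs₃]
  refine Runs.block_cons (B := m * (12 * k + 16) + 2)
    (B' := (R + 1 + (8 * tq + (1 + 1 + 1 + 1))) + 1 + 1 + 1 + 1)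
    ((runs_failureLoop hp₃ hf hm hinp e22₃ (by omega) (H := [] ++ [s₁.reg 17]) rfl
    (ht₂.congr (hr₃ 16 (by omega) (by omega)) rfl) (by simp [hs₃])).mono le_rfl ?_)
  intro s₄ hs₄
  have ht₄ := hs₄.tape
  rw [e21₃] at ht₄
  set F := (List.range m).filter fun c => ClauseHolds inp k a 0 (z <<< a) c k with hF
  have hFm : F.length ≤ m := (List.length_filter_le _ _).trans (by simp)
  have hr₄ : ∀ x, x ≠ 1 → x ≠ 16 → x ≠ 19 → x ≠ 20 → x ≠ 21 → x < 23 ∨ 28 < x →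
      s₄.reg x = s.reg x := by
    intro x h1 h2 h3 h4 h5 h6
    rw [hs₄.reg x h1 h2 h3 h4 h6, hr₃ x h5 h3, hr₂ x h1 h2, hr₁ x h2]
  have hm₄ : ∀ b, b % 4 ≠ 3 → s₄.mem b = s.mem b := by
    intro b hb; rw [hs₄.mem b hb]; exact hm₂ b hb
  have hp₄ : Params N m a l s₄.reg := hp.congr fun x h1 h2 =>
    hr₄ x (by omega) (by omega) (by omega) (by omega) (by omega) (by omega)
  have e16₄ : s₄.reg 16 = F.length + 1 := by rw [ht₄.1]; simp
  have e17₄ : s₄.reg 17 = z :=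
    (hr₄ 17 (by omega) (by omega) (by omega) (by omega) (by omega) (by omega)).trans e17
  refine Runs.block_calc F.length (by simp [Op.eval, e16₄, hp₄.r7]) (by omega) ?_
  refine Runs.block_imm (by omega) ?_
  refine Runs.block_store (4 * 0 + 3) F.length (by simp) (by simp) ?_
  refine Runs.block_calc (z + 1) (by simp [Op.eval, hp₄.r7, e17₄]) (by omega) ?_
  set s₅ := (((s₄.setReg 1 F.length).setReg 2 3).setMem (4 * 0 + 3) F.length).setReg 15 (z + 1)
    with hs₅
  have hr₅ : ∀ x, x ≠ 1 → x ≠ 2 → x ≠ 15 → s₅.reg x = s₄.reg x := by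
    intro x h1 h2 h3; simp [hs₅, h1, h2, h3]
  have ht₅ : s₅.HoldsTape (F.length :: F) :=
    ((ht₄.congr (s' := (s₄.setReg 1 F.length).setReg 2 3) (by simp) rfl).set 0 F.length).setReg
      (by omega)
  have hm₅ : ∀ b, b % 4 ≠ 3 → s₅.mem b = s.mem b := by
    intro b hb
    rw [hs₅, State.setReg_mem, State.setMem_mem, if_neg (by omega)]
    exact hm₄ b hb
  refine Runs.block_cons (B := R + 1) ((runs_clear R).mono le_rfl ?_)
  rintro s₆ ⟨hm₆, hz₆, hr₆⟩
  have hr₆' : ∀ x, x < 32 → x ≠ 1 → x ≠ 2 → x ≠ 15 → x ≠ 16 → x ≠ 19 → x ≠ 20 → x ≠ 21 →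
      x < 23 ∨ 28 < x → s₆.reg x = s.reg x := by
    intro x h0 h1 h2 h3 h4 h5 h6 h7 h8
    rw [hr₆ x h0, hr₅ x h1 h2 h3, hr₄ x h1 h4 h5 h6 h7 h8]
  have e15 : s₆.reg 15 = z + 1 := by rw [hr₆ 15 (by omega)]; simp [hs₅]
  have e14 : s₆.reg 14 = 1 := by
    rw [hr₆' 14 (by omega) (by omega) (by omega) (by omega) (by omega) (by omega) (by omega)
      (by omega) (by omega), hs.layer]
  have hm₆' : ∀ b, b % 4 ≠ 3 → s₆.mem b = s.mem b := fun b hb => by rw [hm₆, hm₅ b hb]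
  have hp₆ : Params N m a l s₆.reg := hp.congr fun x h1 h2 => hr₆' x (by omega) (by omega)
    (by omega) (by omega) (by omega) (by omega) (by omega) (by omega) (by omega)
  have ht₆ : s₆.HoldsTape (F.length :: F) := ht₅.congr (hr₆ 16 (by omega)) hm₆
  have hrep : Represents R (F.length :: F) s₆.reg base ⟨fun _ => 0, base⟩ s₆ := by
    refine ⟨fun x hx => hz₆ x hx, fun _ _ _ => rfl, fun b => ?_, fun b => ?_, ht₆.getD_eq,
      fun _ b => ?_⟩
    · -- all stamps are older than the new time stamp, so the content is that of layer `0`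
      have h1 := hs.stamp b
      rw [← hm₆' _ (by omega)] at h1
      rw [if_neg (by omega), add_zero, hm₆' _ (by omega)]
      exact (hs.base b).symm
    · rw [hm₆' _ (by omega), e15]
      exact (hs.stamp b).trans (by omega)
    · rw [hm₆' _ (by omega)]; exact hs.base b
  rw [encodeFailures_failures] at he
  refine Runs.block_cons (B := 8 * tq) ((hrep.runs_simulate he
    ⟨fun _ => Nat.two_pow_pos _, hbase⟩ hQR hw₀ hp₆.r4 hp₆.r5 hp₆.r6 e14.le).mono
    (by omega) ?_)
  intro s₇ hs₇
  have e29 : s₇.reg 29 = s.reg 29 := by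
    rw [hs₇.own 29 (by omega) (by omega), hr₆' 29 (by omega) (by omega) (by omega) (by omega)
      (by omega) (by omega) (by omega) (by omega) (by omega)]
  have hr₇ : ∀ x, 4 ≤ x → x < 32 → x ≠ 15 → x ≠ 16 → x ≠ 19 → x ≠ 20 → x ≠ 21 →
      x < 23 ∨ 28 < x → s₇.reg x = s.reg x := by
    intro x h0 h1 h2 h3 h4 h5 h6 h7
    rw [hs₇.own x h0 h1, hr₆' x h1 (by omega) (by omega) h2 h3 h4 h5 h6 h7]
  have hle := hs.found_le
  have e32 : s₇.reg 32 = V.reg 0 := hs₇.reg 0 (by omega)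
  set v := if V.reg 0 = 0 then 1 else 0 with hv
  have hv1 : v ≤ 1 := by rw [hv]; split_ifs <;> simp
  refine Runs.block_imm (by omega) ?_
  refine Runs.block_calc v (by simp [Op.eval, e32, hv]) (by omega) ?_
  refine Runs.block_calc (s.reg 29 + v) (by simp [Op.eval, e29]) (by omega) ?_
  set s₈ := ((s₇.setReg 1 0).setReg 1 v).setReg 29 (s.reg 29 + v) with hs₈
  have hr₈ : ∀ x, 4 ≤ x → x < 32 → x ≠ 15 → x ≠ 16 → x ≠ 19 → x ≠ 20 → x ≠ 21 → x ≠ 29 →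
      x < 23 ∨ 28 < x → s₈.reg x = s.reg x := by
    intro x h0 h1 h2 h3 h4 h5 h6 h7 h8
    simp only [hs₈, State.setReg_reg, h7, show x ≠ 1 by omega, if_false]
    exact hr₇ x h0 h1 h2 h3 h4 h5 h6 h8
  have hr₉ : ∀ x, 4 ≤ x → x < 32 → x ≠ 15 → x ≠ 16 → x ≠ 17 → x ≠ 19 → x ≠ 20 → x ≠ 21 →
      x ≠ 29 → x < 23 ∨ 28 < x → (s₈.setReg 17 (z + 1)).reg x = s.reg x := by
    intro x h0 h1 h2 h3 h4 h5 h6 h7 h8 h9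
    rw [State.setReg_reg, if_neg h4]
    exact hr₈ x h0 h1 h2 h3 h5 h6 h7 h8 h9
  have e29' : (s₈.setReg 17 (z + 1)).reg 29 = s.reg 29 + v := by simp [hs₈]
  refine Runs.block_nil ⟨?_, ?_, ⟨by simp, hp.congr fun x h1 h2 => ?_, ?_, ?_, ?_, ?_, ?_,
    fun b => ?_, fun b => ?_⟩⟩
  · rw [hr₈ 17 (by omega) (by omega) (by omega) (by omega) (by omega) (by omega) (by omega)
      (by omega) (by omega), e17]
  · rw [hr₈ 7 (by omega) (by omega) (by omega) (by omega) (by omega) (by omega) (by omega)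
      (by omega) (by omega), hp.r7]
  · exact hr₉ x h1 (by omega) (by omega) (by omega) (by omega) (by omega) (by omega) (by omega)
      (by omega) (by omega)
  · rw [hr₉ 14 (by omega) (by omega) (by omega) (by omega) (by omega) (by omega) (by omega)
      (by omega) (by omega) (by omega), hs.layer]
  · rw [hr₉ 18 (by omega) (by omega) (by omega) (by omega) (by omega) (by omega) (by omega)
      (by omega) (by omega) (by omega), hs.bound]
  · rw [hr₉ 22 (by omega) (by omega) (by omega) (by omega) (by omega) (by omega) (by omega)
      (by omega) (by omega) (by omega), hs.part]
  · rw [e29']; omega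
  · rw [e29']
    have h1 : s.reg 29 + v ≠ 0 ↔ s.reg 29 ≠ 0 ∨ disc z := by
      have : v ≠ 0 ↔ disc z := by
        rw [hv]
        by_cases h0 : V.reg 0 = 0
        · simpa [h0] using hV
        · simpa [h0] using hV
      rw [← this]; omega
    rw [h1, hs.found]
    simp only [Nat.lt_succ_iff_lt_or_eq, or_and_right, exists_or, exists_eq_left]
  · exact (hs₇.base e14 b).trans rfl
  · exact (hs₇.stamp b).trans e15.le

/-- The running time of `Prog.solver`: `tc` and `tq` bound the construction and the update time. -/
def solverTime (k l m R tc tq queries : ℕ) : ℕ :=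
  9 * l + 2 ^ l * m * (12 * k + 30) + 8 * tc + queries * (m * (12 * k + 16) + R + 8 * tq + 22) + 50

/-- If the oracle's construction program `P` and its update program `Q` behave as stated on the
reduction graph and on all failure sets of the reduction, the solver finds out whether some query
disconnects the graph. -/
theorem runs_solver (ha : N / q = a) (hl : a + K = l) (hf : Fits k q K N m l w) (hm : m < 2 ^ l)
    (hinp : ∀ y, inp.getD y 0 < 2 ^ w) (hN : inp.getD 0 0 = N) (hm' : inp.getD 1 0 = m)
    {P Q : Prog} (hPR : P.RegsBelow R) (hQR : Q.RegsBelow R) (hR : 1 ≤ R) {w₀ tc tq : ℕ}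
    (hw₀ : w₀ + 3 ≤ w) {disc : ℕ → Prop} {V : State} {τ : ℕ} (hτ : τ ≤ tc)
    (hP : Exec w₀ (encodeGraph (2 ^ l) (2 ^ l.sqrt)
      (reductionEdges (2 ^ l) m (Violates inp k a) hm.le)) P .init τ V)
    (hQ : ∀ z < 2 ^ (N - a), ∃ (τ : ℕ) (V' : State), τ ≤ tq ∧
      Exec w₀ (encodeFailures (failures (2 ^ l) m
        (fun c => ClauseHolds inp k a 0 (z <<< a) c k) hm.le)) Q V.clearReg τ V' ∧
      (V'.reg 0 ≠ 0 ↔ ¬ disc z)) :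
    Runs w inp (.solver k q K R P Q) .init
      (solverTime k l m R tc tq (2 ^ (N - a)))
      fun s => s.reg 0 ≠ 0 ↔ ∃ b < 2 ^ (N - a), disc b := by
  have hB := hf.graph_lt
  have hw : w ≠ 0 := by rintro rfl; simp at hB
  have hpow : 2 ^ (N - a) ≤ 2 ^ N := Nat.pow_le_pow_right (by norm_num) (Nat.sub_le _ _)
  have hNB := hf.assignment_lt
  have hlit := hf.literal_lt
  set tb := m * (12 * k + 16) + R + 8 * tq + 19 with htb
  have htime : (l * 9 + 15) + ((2 ^ l * m * (12 * k + 30) + 25) + (8 * tc +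
      ((2 ^ (N - a) * (tb + 3) + 2 + (1 + 1 + 1)) + 1 + 1 + 1 + 1 + 1))) ≤
      solverTime k l m R tc tq (2 ^ (N - a)) := by
    unfold solverTime
    rw [show m * (12 * k + 16) + R + 8 * tq + 22 = tb + 3 by omega]
    omega
  refine Runs.mono ?_ htime fun _ h => h
  refine Runs.block_cons ((runs_setup ha hl hf hm hN hm').mono le_rfl ?_)
  rintro s₁ ⟨hp₁, e13, hz₁, hmem₁⟩
  refine Runs.block_cons ((runs_buildGraph hp₁ hf hm hinp e13
    (hz₁ 16 (by omega) (by omega) (by omega))).mono le_rfl ?_)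
  rintro s₂ ⟨ht₂, hm₂, hr₂⟩
  have hr₂' : ∀ x, 14 ≤ x → x ≠ 16 → x ≠ 17 → x ≠ 18 → x ≠ 20 → x ≠ 22 → x < 19 ∨ 28 < x →
      s₂.reg x = 0 := by
    intro x h0 h1 h2 h3 h4 h5 h6
    rw [hr₂ x (by omega) (by omega) h1 h2 h3 h5 h6]
    exact hz₁ x h0 h2 h4
  have hp₂ : Params N m a l s₂.reg := hp₁.congr fun x h1 h2 => hr₂ x (by omega) (by omega)
    (by omega) (by omega) (by omega) (by omega) (by omega)
  have e14 : s₂.reg 14 = 0 := hr₂' 14 (by omega) (by omega) (by omega) (by omega) (by omega)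
    (by omega) (by omega)
  have e15 : s₂.reg 15 = 0 := hr₂' 15 (by omega) (by omega) (by omega) (by omega) (by omega)
    (by omega) (by omega)
  have hm₂' : ∀ b, b % 4 ≠ 3 → s₂.mem b = 0 := fun b hb => (hm₂ b hb).trans (hmem₁ b)
  -- with layer number and time stamp `0`, the construction works on layer `0`
  have hrep : Represents R (encodeGraph (2 ^ l) (2 ^ l.sqrt)
      (reductionEdges (2 ^ l) m (Violates inp k a) hm.le)) s₂.reg (fun _ => 0) .init s₂ := by
    refine ⟨fun x hx => ?_, fun _ _ _ => rfl, fun b => ?_, fun b => ?_, ht₂.getD_eq,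
      fun h => ?_⟩
    · exact hr₂' _ (by omega) (by omega) (by omega) (by omega) (by omega) (by omega) (by omega)
    · rw [e14, ite_self, add_zero, hm₂' _ (by omega)]
      rfl
    · rw [hm₂' _ (by omega)]; omega
    · omega
  have hV0 : State.init.Bounded w₀ := ⟨fun _ => Nat.two_pow_pos _, fun _ => Nat.two_pow_pos _⟩
  have hVb := hP.bounded hV0
  refine Runs.block_cons (B := 8 * tc) ((hrep.runs_simulate hP hV0 hPR hw₀ hp₂.r4 hp₂.r5 hp₂.r6
    (by omega)).mono (by omega) ?_)
  intro s₃ hs₃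
  have hr₃ : ∀ x, 4 ≤ x → x < 32 → s₃.reg x = s₂.reg x := hs₃.own
  have hp₃ : Params N m a l s₃.reg := hp₂.congr fun x h1 h2 => hr₃ x h1 (by omega)
  have hbase : ∀ b, s₃.mem (4 * b) = V.mem b := by
    intro b
    have := hs₃.mem b
    rw [e14, ite_self, add_zero] at this
    exact this.symm
  have hstamp : ∀ b, s₃.mem (4 * b + 2) ≤ 0 := fun b => (hs₃.stamp b).trans e15.le
  have e29 : s₃.reg 29 = 0 := (hr₃ 29 (by omega) (by omega)).trans (hr₂' 29 (by omega) (by omega)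
    (by omega) (by omega) (by omega) (by omega) (by omega))
  refine Runs.block_imm (by omega) ?_
  refine Runs.block_calc (N - a) (by simp [Op.eval, hp₃.r8, hp₃.r10]) (by omega) ?_
  refine Runs.block_calc (2 ^ (N - a)) (by simp [Op.eval, hp₃.r7, Nat.shiftLeft_eq]) (by omega) ?_
  refine Runs.block_imm (by omega) ?_
  refine Runs.block_imm (by omega) ?_
  refine Runs.block_cons (B := 2 ^ (N - a) * (tb + 3) + 2) (B' := 1 + 1 + 1)
    ((Runs.forLoop (Inv := QueryInv N m a l V.mem disc) (M := 2 ^ (N - a)) (C := tb) hw (by omega)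
      (fun z s hs => ⟨hs.counter, hs.bound⟩)
      (fun z s v hs => hs.congr rfl fun x h1 h2 => by rw [State.setReg_reg, if_neg h2])
      (fun z s hz hs => runs_queryBody hf hm (ha.symm.trans_le (Nat.div_le_self _ _)) hinp
        hQR hR hw₀ hVb.2 hz (hQ z hz) hs)
      ?_).mono le_rfl ?_)
  · refine ⟨by simp, hp₃.congr fun x h1 h2 => ?_, by simp, by simp, by simp, by simp [e29],
      by simp [e29], hbase, hstamp⟩
    simp only [State.setReg_reg, show x ≠ 22 by omega, show x ≠ 17 by omega,
      show x ≠ 18 by omega, show x ≠ 14 by omega, show x ≠ 1 by omega, if_false]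
  · intro s₄ hs₄
    have hle := hs₄.found_le
    refine Runs.block_imm (by omega) ?_
    refine Runs.block_calc (s₄.reg 29) (by simp [Op.eval]) (by omega) ?_
    exact Runs.block_nil (by simpa using hs₄.found)

end

end WordRAM

/-! ### Correctness and running time for k-SAT -/

/-- The bound `2 ^ √(log₂ n)` on the number of failures: it is `n ^ o(1)`, but larger than every
power of `log n`. -/
def failureBound (n : ℕ) : ℕ := 2 ^ (Nat.log 2 n).sqrt

/-- Words of `O(N)` bits suffice for the reduction. -/
theorem fits_of_le {k q K N m l w : ℕ} (hl : l ≤ N + K) (hm : m < 2 ^ l)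
    (hw : q + 2 * N + 2 * K + k + 10 ≤ w) : Fits k q K N m l w := by
  have key : ∀ {x e : ℕ}, x < 2 ^ e → e ≤ w → x < 2 ^ w := fun h h' =>
    h.trans_le (Nat.pow_le_pow_right (by norm_num) h')
  refine ⟨key Nat.lt_two_pow_self (by omega), key Nat.lt_two_pow_self (by omega),
    key (e := k + 2 + l) ?_ (by omega), key (e := N + 1) ?_ (by omega),
    Nat.pow_lt_pow_right (by norm_num) (by omega), key (e := l + l + 6) ?_ (by omega)⟩
  · have h1 : k + 2 < 2 ^ (k + 2) := Nat.lt_two_pow_self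
    calc k * m + k + 2 ≤ (k + 2) * (m + 1) := by ring_nf; omega
      _ < 2 ^ (k + 2) * 2 ^ l := Nat.mul_lt_mul_of_lt_of_le h1 hm (by positivity)
      _ = 2 ^ (k + 2 + l) := (pow_add _ _ _).symm
  · have : N < 2 ^ N := Nat.lt_two_pow_self
    rw [pow_succ]; omega
  · rw [pow_add, pow_add]
    have : 0 < 2 ^ l * 2 ^ l := by positivity
    omega

/-- An oracle yields a `k`-SAT algorithm that splits off `N / q` variables and builds a graph on
`2 ^ (N / q + K)` vertices, provided that the number of clauses stays within the number of failures
that the oracle tolerates. -/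
theorem solvesKSAT_solver {P Q : Prog} {c : ℕ} {tc tq : ℕ → ℕ}
    (h : IsGlobalConnectivityOracle failureBound P Q c tc tq) {k q K R : ℕ}
    (hPR : P.RegsBelow R) (hQR : Q.RegsBelow R) (hR : 1 ≤ R) (hK : 4 ≤ K)
    (hkK : ∀ N : ℕ, (2 * N) ^ k ≤ 2 ^ (N / q + K).sqrt) :
    SolvesKSAT k (.solver k q K R P Q) (c * (K + 1) + q + 2 * K + k + 13) fun N =>
      solverTime k (N / q + K) ((2 * N) ^ k) R (tc (2 ^ (N / q + K))) (tq (2 ^ (N / q + K)))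
        (2 ^ (N - N / q)) := by
  intro N φ hφ
  obtain ⟨a, ha⟩ : ∃ a, N / q = a := ⟨_, rfl⟩
  obtain ⟨l, hl⟩ : ∃ l, a + K = l := ⟨_, rfl⟩
  have haN : a ≤ N := ha.symm.trans_le (Nat.div_le_self _ _)
  have hmN : φ.length ≤ (2 * N) ^ k := length_le_of_nodup hφ
  have hml : φ.length ≤ 2 ^ l.sqrt := by
    have := hkK N
    rw [ha, hl] at this
    exact hmN.trans this
  simp only [ha, hl]
  have hsqrt : l.sqrt ≤ l - 2 := by
    by_contra hlt
    have h1 : (l - 1) * (l - 1) ≤ l.sqrt * l.sqrt := Nat.mul_le_mul (by omega) (by omega)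
    have h2 := Nat.sqrt_le l
    obtain ⟨j, rfl⟩ : ∃ j, l = j + 4 := ⟨l - 4, by omega⟩
    rw [show j + 4 - 1 = j + 3 by omega] at h1
    nlinarith
  have hsum : φ.length + 2 ^ a < 2 ^ l := by
    have h1 : 2 ^ l.sqrt ≤ 2 ^ (l - 2) := Nat.pow_le_pow_right (by norm_num) hsqrt
    have h2 : 2 ^ a ≤ 2 ^ (l - 2) := Nat.pow_le_pow_right (by norm_num) (by omega)
    have h3 : 2 ^ l = 2 ^ (l - 2) * 4 := by
      rw [show 4 = 2 ^ 2 by norm_num, ← pow_add, Nat.sub_add_cancel (by omega)]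
    have h4 := Nat.two_pow_pos (l - 2)
    omega
  have hmlt : φ.length < 2 ^ l := (Nat.le_add_right _ _).trans_lt hsum
  set w := (c * (K + 1) + q + 2 * K + k + 13) * (N + 1) with hw
  have hwge : c * (l + 1) + (q + 2 * N + 2 * K + k + 13) ≤ w := by
    have h1 : c * (l + 1) ≤ c * ((K + 1) * (N + 1)) :=
      Nat.mul_le_mul_left c (by nlinarith [Nat.zero_le (K * N)])
    have h2 : w = c * ((K + 1) * (N + 1)) + (q + 2 * K + k + 13) * N
        + (q + 2 * K + k + 13) := by rw [hw]; ring
    have h3 : 2 * N ≤ (q + 2 * K + k + 13) * N := Nat.mul_le_mul_right N (by omega)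
    omega
  have hf : Fits k q K N φ.length l w := fits_of_le (by omega) hmlt (by omega)
  have hinp : ∀ y, (encodeFormula φ).getD y 0 < 2 ^ w :=
    getD_encodeFormula_lt φ (hmlt.trans_le (Nat.pow_le_pow_right (by norm_num) (by omega)))
      hf.literal_lt
  obtain ⟨τ, V, hτ, hP, hQ⟩ := h (2 ^ l) (reductionGraph (2 ^ l) φ.length
    (Violates (encodeFormula φ) k a)) (reductionEdges (2 ^ l) φ.length
      (Violates (encodeFormula φ) k a) hmlt.le) Nat.one_le_two_pow (isEdgeList_reductionEdges _)
  rw [failureBound, Nat.log_pow (by norm_num)] at hP hQ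
  have hrun := runs_solver (disc := fun b => ¬ ((reductionGraph (2 ^ l) φ.length
      (Violates (encodeFormula φ) k a)).induce {v | v ∉ failures (2 ^ l) φ.length
        (fun c => ClauseHolds (encodeFormula φ) k a 0 (b <<< a) c k) hmlt.le}).Connected)
    ha hl hf hmlt hinp (by simp [encodeFormula]) (by simp [encodeFormula]) hPR hQR hR
    (by omega) hτ hP (tq := tq (2 ^ l)) (fun z _ => by
      obtain ⟨τ', V', hτ', he', hV'⟩ := hQ (failures (2 ^ l) φ.length
        (fun c => ClauseHolds (encodeFormula φ) k a 0 (z <<< a) c k) hmlt.le)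
        (nodup_failures _) ((length_failures_le _).trans hml)
        ((length_failures_le _).trans_lt hmlt)
      exact ⟨τ', V', hτ', he', by rw [not_not]; exact hV'⟩)
  obtain ⟨τ', s', hτ', he', hs'⟩ := hrun
  refine ⟨τ', s', hτ'.trans ?_, he', hs'.trans ?_⟩
  · unfold solverTime
    gcongr
  · exact (satisfiable_iff_not_connected φ haN (by omega) hsum hmlt.le).symm

/-- An exponential function outgrows a polynomial. -/
theorem exists_forall_le_two_pow (k q : ℕ) :
    ∃ S₀ : ℕ, ∀ S ≥ S₀, (2 * (q * (S + 1) ^ 2)) ^ k ≤ 2 ^ S := by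
  have h := isLittleO_pow_const_const_pow_of_one_lt (R := ℝ) (3 * k) (r := 2) (by norm_num)
  have h' := (h.comp_tendsto (tendsto_add_atTop_nat 1)).bound (c := 1 / 2) (by norm_num)
  obtain ⟨S₁, hS₁⟩ := eventually_atTop.mp h'
  refine ⟨max S₁ (2 * q), fun S hS => ?_⟩
  have h1 := hS₁ S (le_of_max_le_left hS)
  have h2 : 2 * q ≤ S + 1 := (le_of_max_le_right hS).trans (by omega)
  simp only [Function.comp_apply, norm_pow, Real.norm_natCast, Real.norm_ofNat] at h1
  have h3 : (((S + 1) ^ (3 * k) : ℕ) : ℝ) ≤ ((2 ^ S : ℕ) : ℝ) := by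
    push_cast at h1 ⊢
    rw [pow_succ (2 : ℝ)] at h1
    linarith
  have h4 : (S + 1) ^ (3 * k) ≤ 2 ^ S := by exact_mod_cast h3
  refine le_trans ?_ h4
  rw [pow_mul]
  refine Nat.pow_le_pow_left ?_ k
  calc 2 * (q * (S + 1) ^ 2) = 2 * q * (S + 1) ^ 2 := by ring
    _ ≤ (S + 1) * (S + 1) ^ 2 := Nat.mul_le_mul_right _ h2
    _ = (S + 1) ^ 3 := by ring

/-- The number of clauses is within the bound on the number of failures once the graph is made
larger by a constant factor `2 ^ K`. -/
theorem exists_padding (k : ℕ) {q : ℕ} (hq : 0 < q) :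
    ∃ K ≥ 4, ∀ N : ℕ, (2 * N) ^ k ≤ 2 ^ (N / q + K).sqrt := by
  obtain ⟨S₀, hS₀⟩ := exists_forall_le_two_pow k q
  refine ⟨S₀ * S₀ + 4, by omega, fun N => ?_⟩
  set S := (N / q + (S₀ * S₀ + 4)).sqrt with hS
  have h1 : S₀ ≤ S := Nat.le_sqrt.mpr ((Nat.le_add_right _ 4).trans (Nat.le_add_left _ _))
  have h2 : N / q < (S + 1) ^ 2 := by
    have := Nat.lt_succ_sqrt (N / q + (S₀ * S₀ + 4))
    rw [← hS, Nat.succ_eq_add_one] at this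
    rw [sq]; omega
  have h3 : N ≤ q * (S + 1) ^ 2 := by
    have := (Nat.div_lt_iff_lt_mul hq).mp h2
    rw [mul_comm]; exact this.le
  exact (Nat.pow_le_pow_left (by omega) k).trans (hS₀ S h1)

theorem isSubpolynomial_failureBound : IsSubpolynomial failureBound := by
  intro δ hδ
  refine IsBigO.of_bound (2 ^ (1 / δ)) ?_
  filter_upwards [eventually_ge_atTop 1] with n hn
  have hn' : (1 : ℝ) ≤ n := by exact_mod_cast hn
  set s := (Nat.log 2 n).sqrt with hs
  have h1 : (2 : ℝ) ^ ((s : ℝ) * s) ≤ n := by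
    have : 2 ^ (s * s) ≤ n := (Nat.pow_le_pow_right (by norm_num) (Nat.sqrt_le _)).trans
      (Nat.pow_log_le_self 2 (by omega))
    rw [← Nat.cast_mul, Real.rpow_natCast]
    exact_mod_cast this
  -- of `1 / δ` and `δ * s ^ 2`, at least one is no smaller than `s`
  have h2 : (s : ℝ) ≤ 1 / δ + s * s * δ := by
    have h : 0 ≤ (δ * s - 1) ^ 2 + δ * s := by positivity
    have e : 1 / δ + s * s * δ - s = ((δ * s - 1) ^ 2 + δ * s) / δ := by field_simp; ring
    have := div_nonneg h hδ.le
    linarith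
  rw [Real.norm_natCast, Real.norm_of_nonneg (by positivity)]
  calc ((failureBound n : ℕ) : ℝ) = (2 : ℝ) ^ (s : ℝ) := by
        rw [failureBound, Real.rpow_natCast]; push_cast; rfl
    _ ≤ 2 ^ (1 / δ + s * s * δ) := Real.rpow_le_rpow_of_exponent_le (by norm_num) h2
    _ = 2 ^ (1 / δ) * ((2 : ℝ) ^ ((s : ℝ) * s)) ^ δ := by
        rw [Real.rpow_add (by norm_num), ← Real.rpow_mul (by norm_num)]
    _ ≤ 2 ^ (1 / δ) * (n : ℝ) ^ δ := by gcongr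

/-- The exponent gap may be taken small, and on the positive integers the bound holds without
exceptions. -/
theorem PolyBelow.exists_bound {f : ℕ → ℕ} {a : ℝ} (h : PolyBelow f a) :
    ∃ ε : ℝ, 0 < ε ∧ ε ≤ 1 / 2 ∧ ∃ C : ℝ, 0 < C ∧
      ∀ n : ℕ, 1 ≤ n → (f n : ℝ) ≤ C * (n : ℝ) ^ (a - ε) := by
  obtain ⟨ε, hε, h⟩ := h
  obtain ⟨C, hC, hb⟩ := bound_of_isBigO_nat_atTop h
  refine ⟨min ε (1 / 2), by positivity, min_le_right _ _, C, hC, fun n hn => ?_⟩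
  have hn' : (1 : ℝ) ≤ n := by exact_mod_cast hn
  have hpos : (0 : ℝ) < (n : ℝ) ^ (a - ε) := by positivity
  have := hb (x := n) hpos.ne'
  rw [Real.norm_natCast, Real.norm_of_nonneg hpos.le] at this
  refine this.trans ?_
  have : a - ε ≤ a - min ε (1 / 2) := by linarith [min_le_left ε (1 / 2)]
  gcongr

/-- With `n ≈ 2 ^ (N / q)`, the construction costs about `n ^ (1 + t) ≤ 2 ^ (N / 2)`, and the
`2 ^ N / n` queries cost about `n ^ (1 - ε)` each, in total
`2 ^ N / n ^ ε ≈ 2 ^ ((1 - ε / q) * N)`. -/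
theorem isBigO_solverTime {tc tq : ℕ → ℕ} {t ε Cc Cq : ℝ} (ht : 0 < t) (hε : 0 < ε)
    (hε' : ε ≤ 1 / 2) (hCc : 0 < Cc) (hCq : 0 < Cq)
    (hc : ∀ n : ℕ, 1 ≤ n → (tc n : ℝ) ≤ Cc * (n : ℝ) ^ (1 + t))
    (hq : ∀ n : ℕ, 1 ≤ n → (tq n : ℝ) ≤ Cq * (n : ℝ) ^ (1 - ε))
    {q : ℕ} (hqt : 2 * (1 + t) ≤ q) (k K R : ℕ) :
    (fun N : ℕ => ((solverTime k (N / q + K) ((2 * N) ^ k) R (tc (2 ^ (N / q + K)))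
        (tq (2 ^ (N / q + K))) (2 ^ (N - N / q)) : ℕ) : ℝ)) =O[atTop]
      fun N : ℕ => (N : ℝ) ^ (k + 1) * (2 : ℝ) ^ ((1 - ε / q) * (N : ℝ)) := by
  have hq2 : (2 : ℝ) ≤ q := by linarith
  have hq0 : (0 : ℝ) < q := by linarith
  refine IsBigO.of_bound (9 * (1 + K) + 2 ^ (K : ℝ) * 2 ^ k * (12 * k + 30) +
    8 * (Cc * 2 ^ (K * (1 + t))) + (2 * (2 ^ k * (12 * k + 16) + R + 22) +
      8 * (Cq * 2 ^ (K + 1 : ℝ))) + 50) ?_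
  filter_upwards [eventually_ge_atTop 1] with N hN
  have hN' : (1 : ℝ) ≤ N := by exact_mod_cast hN
  set a := N / q with ha
  -- every summand of the running time is bounded by a constant times `Y * X`
  set X : ℝ := (2 : ℝ) ^ ((1 - ε / q) * (N : ℝ)) with hX
  set Y : ℝ := (N : ℝ) ^ (k + 1) with hY
  have haN : a ≤ N := Nat.div_le_self _ _
  have ha1 : (a : ℝ) ≤ N / q := Nat.cast_div_le
  have ha2 : (N : ℝ) / q ≤ a + 1 := by
    have : N < q * (a + 1) := Nat.lt_mul_div_succ N (by exact_mod_cast hq0)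
    have : (N : ℝ) < q * (a + 1) := by exact_mod_cast this
    rw [div_le_iff₀ hq0]; linarith
  have hNq : (0 : ℝ) ≤ N / q := by positivity
  have hNq2 : (N : ℝ) / q ≤ N / 2 := by gcongr
  have hXe : (1 - ε / q) * (N : ℝ) = N - ε * (N / q) := by ring
  have hexp : ∀ {u v : ℝ}, u ≤ v → (2 : ℝ) ^ u ≤ 2 ^ v := fun h =>
    Real.rpow_le_rpow_of_exponent_le (by norm_num) h
  have hεN : ε * (N / q : ℝ) ≤ 1 / 2 * (N / 2) := mul_le_mul hε' hNq2 hNq (by norm_num)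
  have hX1 : 1 ≤ X := Real.one_le_rpow (by norm_num) (by rw [hXe]; linarith)
  have hY1 : 1 ≤ Y := one_le_pow₀ hN'
  have hNY : (N : ℝ) ≤ Y := le_self_pow₀ hN' (by omega)
  have hm : (((2 * N) ^ k : ℕ) : ℝ) ≤ 2 ^ k * Y := by
    push_cast
    rw [mul_pow, hY]
    gcongr
    omega
  have hl : ((a + K : ℕ) : ℝ) ≤ (1 + K) * Y := by
    push_cast
    have h1 : (a : ℝ) ≤ N := by exact_mod_cast haN
    have h2 : (K : ℝ) * 1 ≤ K * Y := by gcongr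
    linarith
  have hpowcast : ∀ e : ℕ, ((2 ^ e : ℕ) : ℝ) = (2 : ℝ) ^ (e : ℝ) := fun e => by
    rw [Real.rpow_natCast]; push_cast; rfl
  have hn : ((2 ^ (a + K) : ℕ) : ℝ) ≤ 2 ^ (K : ℝ) * X := by
    rw [hpowcast, hX, ← Real.rpow_add (by norm_num)]
    apply hexp
    push_cast
    rw [hXe]; linarith
  have htc : (tc (2 ^ (a + K)) : ℝ) ≤ Cc * 2 ^ (K * (1 + t)) * X := by
    refine (hc _ Nat.one_le_two_pow).trans ?_
    rw [mul_assoc, hpowcast, hX, ← Real.rpow_add (by norm_num), ← Real.rpow_mul (by norm_num)]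
    have h1 : (a : ℝ) * (1 + t) ≤ N / 2 := by
      calc (a : ℝ) * (1 + t) ≤ N / q * (q / 2) := by gcongr; linarith
        _ = N / 2 := by field_simp
    have : ((a + K : ℕ) : ℝ) * (1 + t) ≤ K * (1 + t) + (1 - ε / q) * N := by
      push_cast
      rw [hXe]; nlinarith
    exact mul_le_mul_of_nonneg_left (hexp this) hCc.le
  have hqueries : ((2 ^ (N - a) : ℕ) : ℝ) ≤ 2 * X := by
    rw [hpowcast, hX]
    nth_rewrite 2 [← Real.rpow_one 2]
    rw [← Real.rpow_add (by norm_num), hXe, Nat.cast_sub haN]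
    apply hexp
    have : ε * (N / q : ℝ) ≤ 1 * (N / q) := by gcongr; linarith
    linarith
  have htq : ((2 ^ (N - a) : ℕ) : ℝ) * tq (2 ^ (a + K)) ≤ Cq * 2 ^ (K + 1 : ℝ) * X := by
    calc ((2 ^ (N - a) : ℕ) : ℝ) * tq (2 ^ (a + K))
        ≤ ((2 ^ (N - a) : ℕ) : ℝ) * (Cq * ((2 ^ (a + K) : ℕ) : ℝ) ^ (1 - ε)) := by
          gcongr; exact hq _ Nat.one_le_two_pow
      _ = Cq * 2 ^ (((N - a : ℕ) : ℝ) + ((a + K : ℕ) : ℝ) * (1 - ε)) := by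
          rw [Real.rpow_add (by norm_num), Real.rpow_mul (by norm_num), hpowcast, hpowcast]; ring
      _ ≤ Cq * 2 ^ ((K + 1 : ℝ) + (1 - ε / q) * N) := by
          refine mul_le_mul_of_nonneg_left (hexp ?_) hCq.le
          rw [hXe, Nat.cast_sub haN]
          push_cast
          have h1 : ε * (N / q : ℝ) ≤ ε * (a + 1) := by gcongr
          have h2 : 0 ≤ (K : ℝ) * ε := by positivity
          nlinarith
      _ = Cq * 2 ^ (K + 1 : ℝ) * X := by
          rw [Real.rpow_add (by norm_num), mul_assoc]
  rw [Real.norm_natCast, Real.norm_of_nonneg (by positivity)]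
  have hXY : X ≤ Y * X := le_mul_of_one_le_left (by positivity) hY1
  have hYX : Y ≤ Y * X := le_mul_of_one_le_right (by positivity) hX1
  have h1 : (1 : ℝ) ≤ Y * X := hY1.trans hYX
  have b1 : ((a + K : ℕ) : ℝ) ≤ (1 + K) * (Y * X) := hl.trans (by gcongr)
  have b2 : ((2 ^ (a + K) : ℕ) : ℝ) * (((2 * N) ^ k : ℕ) : ℝ) ≤
      2 ^ (K : ℝ) * 2 ^ k * (Y * X) := by
    calc _ ≤ (2 ^ (K : ℝ) * X) * (2 ^ k * Y) := by gcongr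
      _ = _ := by ring
  have b3 : (tc (2 ^ (a + K)) : ℝ) ≤ Cc * 2 ^ (K * (1 + t)) * (Y * X) := htc.trans (by gcongr)
  have b4 : ((2 ^ (N - a) : ℕ) : ℝ) * (((2 * N) ^ k : ℕ) : ℝ) ≤ 2 * 2 ^ k * (Y * X) := by
    calc _ ≤ (2 * X) * (2 ^ k * Y) := by gcongr
      _ = _ := by ring
  have b5 : ((2 ^ (N - a) : ℕ) : ℝ) ≤ 2 * (Y * X) := hqueries.trans (by gcongr)
  have b6 : ((2 ^ (N - a) : ℕ) : ℝ) * tq (2 ^ (a + K)) ≤ Cq * 2 ^ (K + 1 : ℝ) * (Y * X) :=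
    htq.trans (by gcongr)
  have hT : ((solverTime k (a + K) ((2 * N) ^ k) R (tc (2 ^ (a + K))) (tq (2 ^ (a + K)))
      (2 ^ (N - a)) : ℕ) : ℝ) = 9 * ((a + K : ℕ) : ℝ) +
      ((2 ^ (a + K) : ℕ) : ℝ) * (((2 * N) ^ k : ℕ) : ℝ) * (12 * k + 30) +
      8 * (tc (2 ^ (a + K)) : ℝ) +
      (((2 ^ (N - a) : ℕ) : ℝ) * (((2 * N) ^ k : ℕ) : ℝ) * (12 * k + 16) +
        ((2 ^ (N - a) : ℕ) : ℝ) * (R + 22) +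
        8 * (((2 ^ (N - a) : ℕ) : ℝ) * tq (2 ^ (a + K)))) + 50 := by
    unfold solverTime
    simp only [Nat.cast_add, Nat.cast_mul, Nat.cast_ofNat]
    ring
  rw [hT]
  calc _ ≤ 9 * ((1 + K) * (Y * X)) + 2 ^ (K : ℝ) * 2 ^ k * (Y * X) * (12 * k + 30) +
        8 * (Cc * 2 ^ (K * (1 + t)) * (Y * X)) + (2 * 2 ^ k * (Y * X) * (12 * k + 16) +
          2 * (Y * X) * (R + 22) + 8 * (Cq * 2 ^ (K + 1 : ℝ) * (Y * X))) + 50 * (Y * X) := by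
        gcongr; linarith
    _ = _ := by ring

theorem mainTheorem11 (hSETH : SETH) :
    ∃ d : ℕ → ℕ, IsSubpolynomial d ∧
      ∀ t : ℝ, 0 < t →
        ¬ ∃ (P Q : Prog) (c : ℕ) (tc tq : ℕ → ℕ),
          IsGlobalConnectivityOracle d P Q c tc tq ∧
          PolyBelow tc (1 + t) ∧ PolyBelow tq 1 := by
  refine ⟨failureBound, isSubpolynomial_failureBound, fun t ht => ?_⟩
  rintro ⟨P, Q, c, tc, tq, horacle, htc, htq⟩
  obtain ⟨δ, hδ, -, Cc, hCc, hc⟩ := htc.exists_bound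
  obtain ⟨ε, hε, hε', Cq, hCq, hq⟩ := htq.exists_bound
  -- `q` and the saving `ε / q` depend only on the oracle; `k` is chosen after them
  obtain ⟨q, hqt⟩ := exists_nat_ge (2 * (1 + t))
  have hq0 : (0 : ℝ) < q := by linarith
  obtain ⟨k, hk⟩ := hSETH (ε / q) (by positivity)
  obtain ⟨K, hK, hkK⟩ := exists_padding k (q := q) (by exact_mod_cast hq0)
  obtain ⟨R₁, hR₁⟩ := P.exists_regsBelow
  obtain ⟨R₂, hR₂⟩ := Q.exists_regsBelow
  have hsolve := solvesKSAT_solver horacle (R := R₁ + R₂ + 1) (hR₁.mono (by omega))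
    (hR₂.mono (by omega)) (by omega) hK hkK
  refine hk ⟨_, _, _, k + 1, hsolve, isBigO_solverTime ht hε hε' hCc hCq (fun n hn => ?_) hq hqt
    k K _⟩
  have hn' : (1 : ℝ) ≤ n := by exact_mod_cast hn
  refine (hc n hn).trans ?_
  gcongr
  linarith
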